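/- **Setting.** Let $T=\mathbb C/\Lambda_0$ with $\Lambda_0=\mathbb Z\omega_1\oplus\mathbb Z\omega_2$ be a complex torus, let $C_N$ be a cyclic group of order $N\ge 1$, and let $\rho:C_N\to\mathrm{Aut}(\mathfrak{sl}_2(\mathbb C))$ and $\sigma:C_N\to t(T)$ be injective homomorphisms, where $\mathrm{Aut}$ denotes Lie algebra automorphisms and $t(T)$ is the group of translations of $T$. Put $\mathbb T=T\setminus\sigma(C_N)\cdot\{0\}$ and let $\mathcal O_{\mathbb T}$ be the algebra of meromorphic functions on $T$ that are holomorphic on $\mathbb T$, with the action $\tilde\sigma(\gamma)u=u\circ\sigma(\gamma)^{-1}$. The automorphic Lie algebra is $$\mathfrak A=(\mathfrak{sl}_2\otimes_{\mathbb C}\mathcal O_{\mathbb T})^{\rho\otimes\tilde\sigma(C_N)},$$ the Lie algebra of invariants of the action $\gamma\cdot(A\otimes u)=\rho(\gamma)A\otimes\tilde\sigma(\gamma)u$. Let $e,f,h$ be the standard basis of $\mathfrak{sl}_2$, with $[h,e]=2e$, $[h,f]=-2f$, $[e,f]=h$, and let $\mathrm{Ad}(g)x=gxg^{-1}$. **Theorem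 (genus 1 case).** 1. $\mathfrak A\cong\mathfrak{sl}_2\otimes_{\mathbb C}\mathcal O_{\mathbb T}^{\tilde\sigma(C_N)}$ as complex Lie algebras. 2. Let $\Lambda\subset\mathbb C$ be the preimage of $\sigma(C_N)\cdot\{0\}$. It is a lattice, and $\mathcal O_{\mathbb T}^{\tilde\sigma(C_N)}=\mathbb C[\wp_\Lambda,\wp_\Lambda']$. 3. There are $E,F,H\in\mathfrak A$ such that $$\mathfrak A=\mathbb C\langle E,F,H\rangle\otimes_{\mathbb C}\mathbb C[\wp_\Lambda,\wp_\Lambda'],\qquad [H,E]=2E,\quad [H,F]=-2F,\quad [E,F]=H,$$ that is, $\mathfrak A$ is a free module over $\mathcal O_{\mathbb T}^{\tilde\sigma(C_N)}=\mathbb C[\wp_\Lambda,\wp'_\Lambda]$ with basis $E,F,H$ and these brackets. 4. Let $N\ge 2$, let $r$ be any generator of $C_N$, and let $\alpha\in\mathbb C$ be any lift of $\sigma(r)0$. If $N$ is odd, put $M=N$ and $\hat\Lambda=\Lambda_0$. If $N$ is even, put $M=2N$, write $N\alpha=a\omega_1+b\omega_2$ with $a,b\in\mathbb Z$, and put $\hat\Lambda=2\mathbb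 Z\omega_1\oplus\mathbb Z\omega_2$ if $a$ is odd and $\hat\Lambda=\mathbb Z\omega_1\oplus2\mathbb Z\omega_2$ if $a$ is even. Let $\omega_M=e^{2\pi i/M}$, $\delta_{j}=\mathrm{diag}(\omega_M^{j},\omega_M^{-j})$ and, with $\wp=\wp_{\hat\Lambda}$, $$P_j(z)=\sum_{k=0}^{M-1}\omega_M^{-kj}\,\frac{\wp'(z-k\alpha)}{\wp(z-k\alpha)-\wp(\alpha)}.$$ There are $j\in\mathbb Z$ and $B\in\mathrm{Aut}(\mathfrak{sl}_2)$ with $\rho(r)=B\,\mathrm{Ad}(\delta_{j})\,B^{-1}$. For all such $j$ and $B$ one has $j\not\equiv0\bmod M/2$, and there are $\lambda,\mu\in\mathbb C$, $\mu\neq0$, with $P_{2j}P_{-j}^2-P_{-2j}P_j^2=\lambda P_{-j}P_j+\mu$ on $\mathbb C\setminus\Lambda$, such that $$\Phi_j=\begin{pmatrix}P_{-j}&\frac1\mu P_jP_{-2j}+\frac{\lambda}{2\mu}P_{-j}\\[2pt] P_j&\frac1\mu P_{-j}P_{2j}-\frac{\lambda}{2\mu}P_j\end{pmatrix}$$ satisfies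 $\det\Phi_j=1$ and $\Phi_j(z+\alpha)=\delta_{j}\Phi_j(z)$ on $\mathbb C\setminus\Lambda$, and such that the functions $$E=B\,\mathrm{Ad}(\Phi_j)e,\qquad F=B\,\mathrm{Ad}(\Phi_j)f,\qquad H=B\,\mathrm{Ad}(\Phi_j)h$$ are elements of $\mathfrak A$ that form a normal form of $\mathfrak A$ as in 3. -/

import Mathlib

open scoped TensorProduct

noncomputable section

namespace TorusALia

/-! ### The Lie algebra `sl₂` and its automorphisms -/

/-- The complex Lie algebra `sl₂` of traceless `2 × 2` matrices. -/
abbrev SL2 : Type := LieAlgebra.SpecialLinear.sl (Fin 2) ℂ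

/-- The standard element `e` of `sl₂`. -/
def stdE : SL2 := ⟨!![0, 1; 0, 0], by simp [LieAlgebra.SpecialLinear.sl, Matrix.trace_fin_two]⟩

/-- The standard element `f` of `sl₂`. -/
def stdF : SL2 := ⟨!![0, 0; 1, 0], by simp [LieAlgebra.SpecialLinear.sl, Matrix.trace_fin_two]⟩

/-- The standard element `h` of `sl₂`. -/
def stdH : SL2 := ⟨!![1, 0; 0, -1], by simp [LieAlgebra.SpecialLinear.sl, Matrix.trace_fin_two]⟩

/-- `Aut(sl₂)`: the Lie algebra automorphisms of `sl₂`, a group under composition. -/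
abbrev AutSL2 : Type := SL2 ≃ₗ⁅ℂ⁆ SL2

instance : Group AutSL2 where
  mul a b := b.trans a
  one := 1
  inv a := a.symm
  mul_assoc _ _ _ := rfl
  one_mul _ := rfl
  mul_one _ := rfl
  inv_mul_cancel a := by
    ext1 x
    exact a.symm_apply_apply x

/-- `Ad(g) x = g x g⁻¹`, for `x` in `sl₂` (of interest for invertible `g`). -/
def Ad (g : Matrix (Fin 2) (Fin 2) ℂ) (x : SL2) : SL2 :=
  ⟨g * x.1 * g⁻¹, by
    have hx : Matrix.trace x.1 = 0 := by simpa [LieAlgebra.SpecialLinear.sl] using x.2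
    have : Matrix.trace (g * x.1 * g⁻¹) = 0 := by
      rw [Matrix.trace_mul_cycle]
      by_cases hg : IsUnit g.det
      · rw [Matrix.nonsing_inv_mul g hg, one_mul, hx]
      · rw [Matrix.nonsing_inv_apply_not_isUnit g hg]
        simp
    simpa [LieAlgebra.SpecialLinear.sl] using this⟩

/-! ### The torus, its translations and the punctured torus -/

/-- The complex torus `T = ℂ / (ℤ ω₁ + ℤ ω₂)`. -/
abbrev Torus (L : PeriodPair) : Type := ℂ ⧸ L.lattice

/-- The projection `ℂ → T`. -/
def proj (L : PeriodPair) (z : ℂ) : Torus L := Submodule.Quotient.mk z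

/-- The group `t(T)` of translations of the torus `T`. -/
def translations (L : PeriodPair) : Subgroup (Equiv.Perm (Torus L)) where
  carrier := {s | ∃ a : Torus L, ∀ z, s z = z + a}
  mul_mem' := by
    rintro s t ⟨a, ha⟩ ⟨b, hb⟩
    exact ⟨b + a, fun z => by rw [Equiv.Perm.mul_apply, ha, hb, add_assoc]⟩
  one_mem' := ⟨0, fun z => by simp⟩
  inv_mem' := by
    rintro s ⟨a, ha⟩
    exact ⟨-a, fun z => by rw [Equiv.Perm.inv_eq_iff_eq, ha]; simp⟩

variable {L : PeriodPair} {Γ : Type*} [Group Γ]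

/-- The orbit `Γ · {0}` in the torus. -/
def orbitZero (σ : Γ →* translations L) : Set (Torus L) :=
  {p | ∃ γ : Γ, (σ γ).1 0 = p}

/-- The punctured torus `𝕋 = T ∖ Γ · {0}`. -/
abbrev Punctured (σ : Γ →* translations L) : Type := {p : Torus L // p ∉ orbitZero σ}

/-- The action of `γ` on the punctured torus. -/
def move (σ : Γ →* translations L) (γ : Γ) (p : Punctured σ) : Punctured σ :=
  ⟨(σ γ).1 p.1, by
    rintro ⟨δ, hδ⟩
    refine p.2 ⟨γ⁻¹ * δ, ?_⟩
    rw [map_mul, map_inv, Subgroup.coe_mul, Subgroup.coe_inv, Equiv.Perm.mul_apply, hδ]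
    exact Equiv.symm_apply_apply _ _⟩

/-! ### The algebra of functions and its invariants -/

/-- The function `u` on the punctured torus is holomorphic, and meromorphic at the punctures:
pulled back along `ℂ → T`, whose local inverses are the charts of `T`, it is the restriction of a
meromorphic function on `ℂ` that is holomorphic away from the preimage of the punctures. -/
def IsRegular {σ : Γ →* translations L} (u : Punctured σ → ℂ) : Prop :=
  ∃ U : ℂ → ℂ, (∀ z, MeromorphicAt U z) ∧
    ∀ (z : ℂ) (hz : proj L z ∉ orbitZero σ), AnalyticAt ℂ U z ∧ U z = u ⟨proj L z, hz⟩

/-- The algebra `𝒪_𝕋` of meromorphic functions on `T` that are holomorphic on `𝕋`. -/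
def Fun (σ : Γ →* translations L) : Subalgebra ℂ (Punctured σ → ℂ) where
  carrier := {u | IsRegular u}
  mul_mem' := by
    rintro u v ⟨U, hU, hU'⟩ ⟨V, hV, hV'⟩
    exact ⟨U * V, fun z => (hU z).mul (hV z), fun z hz =>
      ⟨(hU' z hz).1.mul (hV' z hz).1, by simp [(hU' z hz).2, (hV' z hz).2]⟩⟩
  add_mem' := by
    rintro u v ⟨U, hU, hU'⟩ ⟨V, hV, hV'⟩
    exact ⟨U + V, fun z => (hU z).add (hV z), fun z hz =>
      ⟨(hU' z hz).1.add (hV' z hz).1, by simp [(hU' z hz).2, (hV' z hz).2]⟩⟩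
  algebraMap_mem' c := ⟨fun _ => c, fun z => MeromorphicAt.const c z, fun _ _ =>
    ⟨analyticAt_const, rfl⟩⟩

theorem IsRegular.comp_move {σ : Γ →* translations L} {u : Punctured σ → ℂ} (hu : IsRegular u)
    (γ : Γ) : IsRegular fun p => u (move σ γ p) := by
  obtain ⟨U, hU, hU'⟩ := hu
  obtain ⟨a, ha⟩ := (σ γ).2
  obtain ⟨b, rfl⟩ := Submodule.Quotient.mk_surjective _ a
  have key : ∀ z, (σ γ).1 (proj L z) = proj L (z + b) := fun z => ha _
  refine ⟨fun z => U (z + b), fun z => ?_, fun z hz => ?_⟩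
  · exact meromorphicAt_fun_comp_add_const_iff_meromorphicAt.2 (hU (z + b))
  · have hm := (move σ γ ⟨proj L z, hz⟩).2
    have hm' : proj L (z + b) ∉ orbitZero σ := by
      rw [← key]
      exact hm
    obtain ⟨h1, h2⟩ := hU' (z + b) hm'
    refine ⟨?_, ?_⟩
    · exact AnalyticAt.fun_comp (f := fun z => z + b) h1 (analyticAt_id.add analyticAt_const)
    · change U (z + b) = _
      rw [h2]
      congr 1
      exact Subtype.ext (key z).symm

/-- The action of `γ` on functions: `(γ · u)(p) = u(σ(γ)⁻¹ p)`. -/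
def funAct (σ : Γ →* translations L) (γ : Γ) : Fun σ →ₐ[ℂ] Fun σ where
  toFun u := ⟨fun p => u.1 (move σ γ⁻¹ p), IsRegular.comp_move u.2 γ⁻¹⟩
  map_one' := rfl
  map_mul' _ _ := rfl
  map_zero' := rfl
  map_add' _ _ := rfl
  commutes' _ := rfl

/-- The algebra of invariant functions `𝒪_𝕋 ^ Γ`. -/
def invFun (σ : Γ →* translations L) : Subalgebra ℂ (Fun σ) where
  carrier := {u | ∀ γ, funAct σ γ u = u}
  mul_mem' hu hv γ := by rw [map_mul, hu γ, hv γ]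
  add_mem' hu hv γ := by rw [map_add, hu γ, hv γ]
  algebraMap_mem' c γ := (funAct σ γ).commutes c

/-- `u` is the function on `𝕋` induced by the function `U` on `ℂ`. -/
def IsInduced {σ : Γ →* translations L} (u : Fun σ) (U : ℂ → ℂ) : Prop :=
  ∀ (z : ℂ) (hz : proj L z ∉ orbitZero σ), u.1 ⟨proj L z, hz⟩ = U z

/-! ### Current algebras and automorphic Lie algebras -/

/-- The tensor product `𝔤 ⊗ A` of a Lie algebra and a commutative algebra (the scalars are written
on the left), with the bracket `⁅a ⊗ x, b ⊗ y⁆ = ab ⊗ ⁅x, y⁆`. -/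
abbrev CurrentAlg (A : Type*) [CommRing A] [Algebra ℂ A] (𝔤 : Type*) [LieRing 𝔤]
    [LieAlgebra ℂ 𝔤] := A ⊗[ℂ] 𝔤

/-- The current algebra `sl₂ ⊗ 𝒪_𝕋`. -/
abbrev Current (σ : Γ →* translations L) := CurrentAlg (Fun σ) SL2

/-- The diagonal action `γ · (u ⊗ A) = (γ · u) ⊗ ρ(γ) A`. -/
def act (ρ : Γ →* AutSL2) (σ : Γ →* translations L) (γ : Γ) : Current σ →ₗ⁅ℂ⁆ Current σ :=
  LieAlgebra.ExtendScalars.map (funAct σ γ) (ρ γ : SL2 →ₗ⁅ℂ⁆ SL2)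

/-- The automorphic Lie algebra: the invariants of the diagonal action of `Γ`. -/
def aLia (ρ : Γ →* AutSL2) (σ : Γ →* translations L) : LieSubalgebra ℂ (Current σ) where
  carrier := {a | ∀ γ, act ρ σ γ a = a}
  add_mem' ha hb γ := by rw [map_add, ha γ, hb γ]
  zero_mem' γ := map_zero _
  smul_mem' c a ha γ := by rw [map_smul, ha γ]
  lie_mem' ha hb γ := by rw [LieHom.map_lie, ha γ, hb γ]

/-- The value at `p` of an element of the current algebra: `(u ⊗ A)(p) = u(p) A`. -/
def eval {σ : Γ →* translations L} (p : Punctured σ) : Current σ →ₗ[ℂ] SL2 :=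
  TensorProduct.lift (LinearMap.lsmul ℂ SL2 ∘ₗ
    (LinearMap.proj p : (Punctured σ → ℂ) →ₗ[ℂ] ℂ) ∘ₗ (Fun σ).val.toLinearMap)

/-- The automorphic Lie algebra is `ℂ⟨E, F, H⟩ ⊗ 𝒪_𝕋 ^ Γ`, that is, a free `𝒪_𝕋 ^ Γ`-module with
basis `E, F, H`, with the brackets of `sl₂`. -/
structure IsNormalForm (ρ : Γ →* AutSL2) (σ : Γ →* translations L) (E F H : Current σ) :
    Prop where
  linearIndependent : LinearIndependent (invFun σ) ![E, F, H]
  span_eq : (Submodule.span (invFun σ) {E, F, H} : Set (Current σ)) = aLia ρ σ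
  lie_H_E : ⁅H, E⁆ = (2 : ℂ) • E
  lie_H_F : ⁅H, F⁆ = (-2 : ℂ) • F
  lie_E_F : ⁅E, F⁆ = H

/-! ### The functions `P_j` and the intertwiner `Φ_j` -/

/-- `ω_M ^ k`, where `ω_M = exp (2πi / M)`. -/
def omega (M : ℕ) (k : ℤ) : ℂ := Complex.exp (2 * Real.pi * Complex.I * k / M)

/-- `P_j(z) = ∑_{k < M} ω_M ^ {-kj} ℘'(z - kα) / (℘(z - kα) - ℘(α))`, as a function on `ℂ`. -/
def P (L : PeriodPair) (M : ℕ) (α : ℂ) (j : ℤ) (z : ℂ) : ℂ :=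
  ∑ k ∈ Finset.range M, omega M (-(k * j)) *
    (L.derivWeierstrassP (z - k * α) / (L.weierstrassP (z - k * α) - L.weierstrassP α))

/-- The matrix `Φ_j(z)`, with parameters `lam` and `mu`. -/
def Phi (L : PeriodPair) (M : ℕ) (α : ℂ) (j : ℤ) (lam mu : ℂ) (z : ℂ) :
    Matrix (Fin 2) (Fin 2) ℂ :=
  !![P L M α (-j) z,
      1 / mu * P L M α j z * P L M α (-2 * j) z + lam / (2 * mu) * P L M α (-j) z;
    P L M α j z,
      1 / mu * P L M α (-j) z * P L M α (2 * j) z - lam / (2 * mu) * P L M α j z]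

/-- The diagonal matrix `δ_{j,M} = diag(ω_M ^ j, ω_M ^ {-j})`. -/
def delta (M : ℕ) (j : ℤ) : Matrix (Fin 2) (Fin 2) ℂ := !![omega M j, 0; 0, omega M (-j)]

/-- The periods `2ω₁, ω₂`. -/
def doubleFst (L : PeriodPair) : PeriodPair where
  ω₁ := 2 * L.ω₁
  ω₂ := L.ω₂
  indep := by
    have h := LinearIndependent.pair_iff.1 L.indep
    refine LinearIndependent.pair_iff.2 fun s t hst => ?_
    have := h (s * 2) t (by simpa [mul_assoc] using hst)
    simpa using this

/-- The periods `ω₁, 2ω₂`. -/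
def doubleSnd (L : PeriodPair) : PeriodPair where
  ω₁ := L.ω₁
  ω₂ := 2 * L.ω₂
  indep := by
    have h := LinearIndependent.pair_iff.1 L.indep
    refine LinearIndependent.pair_iff.2 fun s t hst => ?_
    have := h s (t * 2) (by simpa [mul_assoc] using hst)
    simpa using this

open Classical in
/-- The periods of the torus `T̂` on which `Φ_j` is built. If `N` is odd, `T̂ = T`. If `N` is even,
then `T̂` is a double cover of `T`; with `N α = a ω₁ + b ω₂`, the first period is doubled if `a` is
odd, and the second one otherwise. -/
def cover (L : PeriodPair) (N : ℕ) (α : ℂ) : PeriodPair :=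
  if Odd N then L
  else if ∃ a b : ℤ, Odd a ∧ N * α = a * L.ω₁ + b * L.ω₂ then doubleFst L
  else doubleSnd L

/-- The order of `α` in `T̂`: it is `N` if `N` is odd and `2N` if `N` is even. -/
def coverOrder (N : ℕ) : ℕ := if Odd N then N else 2 * N

end TorusALia

end

/-! The algebra is trivialised by a gauge transformation. Let `Ψ` be a matrix function, meromorphic
on `ℂ`, holomorphic and of determinant one off `Λ`, such that translation of `z` by `b` turns `B
Ad(Ψ)` into `ρ(γ) B Ad(Ψ)` whenever `σ(γ)` translates by `b`. Undoing `B Ad(Ψ)` turns equivariant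
`sl₂`-valued functions into `Λ`-periodic ones, so the images of `e, f, h` are a basis over the
invariant functions (`exists_isNormalForm`). Removing poles at `0` one order at a time shows that
these functions are the polynomials in `℘_Λ` and `℘_Λ'`.

To find `Ψ`: automorphisms of `sl₂` are inner and those of finite order are diagonalisable, so
`ρ(r)` is conjugate to some `Ad(δ_j)` (`exists_conj_delta`). For even `N` the power `δ_j ^ N` is
only a sign, so the construction lives on a double cover of `T` on which `α` has order `2N`; the
sign is central and invisible to `Ad`. The functions `P_j` are the components of the logarithmic
derivative of `℘ - ℘(α)` under translation by `α`. They have at most simple poles, all in `Λ`, and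
`P_j(z + α) = ω^{-j} P_j(z)`. Hence the columns `(P_{-j}, P_j)`, `(P_{-j}, -P_j)` and `(P_j P_{-2j},
P_{-j} P_{2j})` all transform by `δ_j`. The first and third have determinant `G = P_{2j} P_{-j}² -
P_{-2j} P_j²`, which is `Λ`-elliptic. Its triple pole cancels by symmetry, a multiple of `P_j
P_{-j}` removes the double pole, and an elliptic function with at most one simple pole is constant:
this gives `λ` and `μ` (`exists_P_relation`). If `μ` were `0`, then `P_{2j} P_{-j} / P_j` would be
`Λ`-elliptic with a single simple pole, because `P_j` and `P_{-j}` have no common zero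
(`P_neg_ne_zero`).

The function theory rests on Liouville's theorem and the absence of a single simple pole
(`Per.residue_eq_zero`). `LeadAt f a n c` allows `c = 0`, so it expresses order at least `n`. -/

noncomputable section

namespace TorusALia

open Filter Topology Set

/-! ### Leading terms of meromorphic functions -/

/-- Near `a`, the function `f` is `(w - a) ^ n` times an analytic function with value `c` at `a`. -/
def LeadAt (f : ℂ → ℂ) (a : ℂ) (n : ℤ) (c : ℂ) : Prop :=
  ∃ g : ℂ → ℂ, AnalyticAt ℂ g a ∧ g a = c ∧ ∀ᶠ w in 𝓝[≠] a, f w = (w - a) ^ n * g w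

namespace LeadAt

variable {f g : ℂ → ℂ} {a b c d : ℂ} {m n : ℤ}

theorem congr (hf : LeadAt f a n c) (h : ∀ᶠ w in 𝓝[≠] a, g w = f w) : LeadAt g a n c := by
  obtain ⟨u, hu, hc, he⟩ := hf
  exact ⟨u, hu, hc, by filter_upwards [he, h] with w h1 h2; rw [h2, h1]⟩

theorem meromorphicAt (hf : LeadAt f a n c) : MeromorphicAt f a := by
  obtain ⟨u, hu, hc, he⟩ := hf
  exact MeromorphicAt.iff_eventuallyEq_zpow_smul_analyticAt.2 ⟨n, u, hu, he⟩

theorem add (hf : LeadAt f a n c) (hg : LeadAt g a n d) :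
    LeadAt (fun z => f z + g z) a n (c + d) := by
  obtain ⟨u, hu, rfl, he⟩ := hf
  obtain ⟨v, hv, rfl, he'⟩ := hg
  exact ⟨u + v, hu.add hv, rfl, by
    filter_upwards [he, he'] with w h1 h2; rw [h1, h2, Pi.add_apply, mul_add]⟩

theorem const_mul (hf : LeadAt f a n c) (k : ℂ) : LeadAt (fun z => k * f z) a n (k * c) := by
  obtain ⟨u, hu, rfl, he⟩ := hf
  exact ⟨fun z => k * u z, analyticAt_const.mul hu, rfl, by
    filter_upwards [he] with w h1; rw [h1]; ring⟩

theorem neg (hf : LeadAt f a n c) : LeadAt (fun z => - f z) a n (-c) := by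
  simpa using hf.const_mul (-1)

theorem sub (hf : LeadAt f a n c) (hg : LeadAt g a n d) :
    LeadAt (fun z => f z - g z) a n (c - d) := by
  simpa [sub_eq_add_neg] using hf.add hg.neg

theorem mul (hf : LeadAt f a n c) (hg : LeadAt g a m d) :
    LeadAt (fun z => f z * g z) a (n + m) (c * d) := by
  obtain ⟨u, hu, rfl, he⟩ := hf
  obtain ⟨v, hv, rfl, he'⟩ := hg
  refine ⟨fun z => u z * v z, hu.mul hv, rfl, ?_⟩
  filter_upwards [he, he', self_mem_nhdsWithin] with w h1 h2 hw
  rw [h1, h2, zpow_add₀ (sub_ne_zero.2 hw)]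
  ring

theorem inv (hf : LeadAt f a n c) (hc : c ≠ 0) : LeadAt (fun z => (f z)⁻¹) a (-n) c⁻¹ := by
  obtain ⟨u, hu, rfl, he⟩ := hf
  refine ⟨fun z => (u z)⁻¹, hu.inv hc, rfl, ?_⟩
  filter_upwards [he] with w h1
  rw [h1, mul_inv, zpow_neg]

theorem div (hf : LeadAt f a n c) (hg : LeadAt g a m d) (hd : d ≠ 0) :
    LeadAt (fun z => f z / g z) a (n - m) (c / d) := by
  simpa [div_eq_mul_inv, sub_eq_add_neg] using hf.mul (hg.inv hd)

theorem pow (hf : LeadAt f a n c) (k : ℕ) : LeadAt (fun z => f z ^ k) a (k * n) (c ^ k) := by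
  induction k with
  | zero => exact ⟨fun _ => 1, analyticAt_const, by simp, by simp⟩
  | succ k ih => simpa [pow_succ, add_mul] using ih.mul hf

theorem _root_.AnalyticAt.leadAt (hf : AnalyticAt ℂ f a) : LeadAt f a 0 (f a) :=
  ⟨f, hf, rfl, by simp⟩

theorem const (k : ℂ) : LeadAt (fun _ => k) a 0 k := analyticAt_const.leadAt

/-- A vanishing leading coefficient allows to raise the order. -/
theorem succ (hf : LeadAt f a n 0) : ∃ c, LeadAt f a (n + 1) c := by
  obtain ⟨u, hu, hc, he⟩ := hf
  obtain ⟨p, hp⟩ := hu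
  have h := hp.has_fpower_series_dslope_fslope.analyticAt
  refine ⟨_, dslope u a, h, rfl, ?_⟩
  filter_upwards [he, self_mem_nhdsWithin] with w h1 hw
  rw [h1, dslope_of_ne _ hw, slope_def_field, hc, zpow_add_one₀ (sub_ne_zero.2 hw)]
  have := sub_ne_zero.2 hw
  field_simp
  ring

/-- Lowering the order makes the leading coefficient vanish. -/
theorem lower (hf : LeadAt f a n c) : LeadAt f a (n - 1) 0 := by
  obtain ⟨u, hu, rfl, he⟩ := hf
  refine ⟨fun z => (z - a) * u z, (analyticAt_id.sub analyticAt_const).mul hu, by simp, ?_⟩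
  filter_upwards [he, self_mem_nhdsWithin] with w h1 hw
  rw [h1, zpow_sub_one₀ (sub_ne_zero.2 hw)]
  have := sub_ne_zero.2 hw
  field_simp

theorem lower_le (hf : LeadAt f a n c) (h : m < n) : LeadAt f a m 0 := by
  obtain ⟨k, rfl⟩ : ∃ k : ℕ, m = n - 1 - k := ⟨(n - 1 - m).toNat, by omega⟩
  clear h
  induction k with
  | zero => simpa using hf.lower
  | succ k ih => simpa [sub_sub, add_assoc] using ih.lower

theorem mono (hf : LeadAt f a n c) (h : m ≤ n) : ∃ d, LeadAt f a m d := by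
  rcases h.lt_or_eq with h | rfl
  · exact ⟨0, hf.lower_le h⟩
  · exact ⟨c, hf⟩

theorem unique (hf : LeadAt f a n c) (hg : LeadAt f a n d) : c = d := by
  obtain ⟨u, hu, rfl, he⟩ := hf
  obtain ⟨v, hv, rfl, he'⟩ := hg
  have h : u =ᶠ[𝓝[≠] a] v := by
    filter_upwards [he, he', self_mem_nhdsWithin] with w h1 h2 hw
    exact mul_left_cancel₀ (zpow_ne_zero n (sub_ne_zero.2 hw)) (h1.symm.trans h2)
  exact tendsto_nhds_unique_of_eventuallyEq (hu.continuousAt.tendsto.mono_left nhdsWithin_le_nhds)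
    (hv.continuousAt.tendsto.mono_left nhdsWithin_le_nhds) h

theorem eq_zero (hf : LeadAt f a n c) (h : ∀ᶠ w in 𝓝[≠] a, f w = 0) : c = 0 := by
  refine hf.unique (d := 0) ⟨0, analyticAt_const, rfl, ?_⟩
  simpa using h

theorem eventually_ne_zero (hf : LeadAt f a n c) (hc : c ≠ 0) : ∀ᶠ w in 𝓝[≠] a, f w ≠ 0 := by
  obtain ⟨u, hu, rfl, he⟩ := hf
  filter_upwards [he, self_mem_nhdsWithin,
    (hu.continuousAt.eventually_ne hc).filter_mono nhdsWithin_le_nhds] with w h1 hw h2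
  rw [h1]
  exact mul_ne_zero (zpow_ne_zero n (sub_ne_zero.2 hw)) h2

theorem tendsto (hf : LeadAt f a 0 c) : Tendsto f (𝓝[≠] a) (𝓝 c) := by
  obtain ⟨u, hu, rfl, he⟩ := hf
  refine (hu.continuousAt.tendsto.mono_left nhdsWithin_le_nhds).congr' ?_
  filter_upwards [he] with w h1
  simp [h1]

theorem comp_add (hf : LeadAt f a n c) (b : ℂ) : LeadAt (fun z => f (z + b)) (a - b) n c := by
  obtain ⟨u, hu, rfl, he⟩ := hf
  refine ⟨fun z => u (z + b), ?_, by simp, ?_⟩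
  · exact AnalyticAt.fun_comp (f := fun z => z + b) (by simpa using hu)
      (analyticAt_id.add analyticAt_const)
  · have h : Tendsto (fun z : ℂ => z + b) (𝓝[≠] (a - b)) (𝓝[≠] a) := by
      refine tendsto_nhdsWithin_iff.2 ⟨?_, ?_⟩
      · have : ContinuousAt (fun z : ℂ => z + b) (a - b) := by fun_prop
        simpa [ContinuousAt] using this.tendsto.mono_left nhdsWithin_le_nhds
      · filter_upwards [self_mem_nhdsWithin] with w hw h
        exact hw (eq_sub_of_add_eq h)
    filter_upwards [h.eventually he] with w hw
    rw [hw]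
    congr 2
    ring

theorem comp_neg (hf : LeadAt f a n c) : LeadAt (fun z => f (-z)) (-a) n ((-1) ^ n * c) := by
  obtain ⟨u, hu, rfl, he⟩ := hf
  refine ⟨fun z => (-1) ^ n * u (-z), ?_, by simp, ?_⟩
  · refine analyticAt_const.mul ?_
    exact AnalyticAt.fun_comp (f := fun z => -z) (by simpa using hu) analyticAt_id.neg
  · have h : Tendsto (fun z : ℂ => -z) (𝓝[≠] (-a)) (𝓝[≠] a) := by
      refine tendsto_nhdsWithin_iff.2 ⟨?_, ?_⟩
      · have : ContinuousAt (fun z : ℂ => -z) (-a) := by fun_prop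
        simpa [ContinuousAt] using this.tendsto.mono_left nhdsWithin_le_nhds
      · filter_upwards [self_mem_nhdsWithin] with w hw h
        exact hw (by rw [← neg_neg w]; exact congrArg Neg.neg h)
    filter_upwards [h.eventually he] with w hw
    rw [hw, ← mul_assoc, ← mul_zpow]
    congr 2
    ring

protected theorem deriv (hf : LeadAt f a n c) : LeadAt (deriv f) a (n - 1) (n * c) := by
  obtain ⟨u, hu, rfl, he⟩ := hf
  refine ⟨fun z => n * u z + (z - a) * deriv u z,
    (analyticAt_const.mul hu).add ((analyticAt_id.sub analyticAt_const).mul hu.deriv), by simp, ?_⟩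
  -- Differentiation at `w` needs the factorisation on a neighbourhood of `w`, not only at `w`.
  have he2 : ∀ᶠ w in 𝓝[≠] a, ∀ᶠ z in 𝓝 w, f z = (z - a) ^ n * u z := by
    rw [eventually_nhdsWithin_iff] at he
    filter_upwards [(eventually_eventually_nhds.2 he).filter_mono nhdsWithin_le_nhds,
      self_mem_nhdsWithin] with w hw hwa
    filter_upwards [hw, isOpen_ne.mem_nhds hwa] with z h1 h2 using h1 h2
  filter_upwards [he2, self_mem_nhdsWithin,
    hu.eventually_analyticAt.filter_mono nhdsWithin_le_nhds] with w hw hwa hua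
  have hne : w - a ≠ 0 := sub_ne_zero.2 hwa
  rw [EventuallyEq.deriv_eq hw]
  have h1 : HasDerivAt (fun z => (z - a) ^ n) (n * (w - a) ^ (n - 1)) w := by
    simpa using (hasDerivAt_zpow n (w - a) (Or.inl hne)).comp_sub_const w a
  rw [(h1.fun_mul hua.differentiableAt.hasDerivAt).deriv, zpow_sub_one₀ hne]
  field_simp

/-- The mechanism by which products of shifted functions below lose their simple poles. -/
theorem mul_zero_one (hf : LeadAt f a (-1) c) (hg : LeadAt g a 0 0) :
    ∃ d, LeadAt (fun z => f z * g z) a 0 d := by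
  obtain ⟨e, he⟩ := hg.succ
  exact ⟨_, by simpa using hf.mul he⟩

end LeadAt

theorem exists_leadAt {f : ℂ → ℂ} {a : ℂ} (hf : MeromorphicAt f a) : ∃ n c, LeadAt f a n c := by
  obtain ⟨n, g, hg, he⟩ := MeromorphicAt.iff_eventuallyEq_zpow_smul_analyticAt.1 hf
  exact ⟨n, g a, g, hg, rfl, he⟩

/-- The order of vanishing of an analytic function that is not locally zero. -/
theorem exists_leadAt_ne_zero {f : ℂ → ℂ} {a : ℂ} (hf : AnalyticAt ℂ f a)
    (h0 : ¬ ∀ᶠ w in 𝓝 a, f w = 0) : ∃ (m : ℕ) (c : ℂ), c ≠ 0 ∧ LeadAt f a m c := by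
  obtain ⟨m, g, hg, hne, he⟩ := hf.exists_eventuallyEq_pow_smul_nonzero_iff.2 h0
  exact ⟨m, g a, hne, g, hg, rfl, by
    filter_upwards [he.filter_mono nhdsWithin_le_nhds] with w hw
    simpa using hw⟩

/-- The function `f` with its removable singularities removed. -/
def reg (f : ℂ → ℂ) (z : ℂ) : ℂ := limUnder (𝓝[≠] z) f

theorem LeadAt.reg_eq {f : ℂ → ℂ} {a c : ℂ} (hf : LeadAt f a 0 c) : reg f a = c :=
  hf.tendsto.limUnder_eq

theorem reg_eq_of_continuousAt {f : ℂ → ℂ} {a : ℂ} (hf : ContinuousAt f a) : reg f a = f a :=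
  (hf.tendsto.mono_left nhdsWithin_le_nhds).limUnder_eq

theorem eventually_reg_eq {f : ℂ → ℂ} {a : ℂ} (hf : MeromorphicAt f a) :
    ∀ᶠ w in 𝓝[≠] a, reg f w = f w := by
  filter_upwards [hf.eventually_continuousAt] with w hw using reg_eq_of_continuousAt hw

theorem LeadAt.reg {f : ℂ → ℂ} {a c : ℂ} {n : ℤ} (hf : LeadAt f a n c) :
    LeadAt (reg f) a n c :=
  hf.congr (eventually_reg_eq hf.meromorphicAt)

theorem LeadAt.analyticAt_reg {f : ℂ → ℂ} {a c : ℂ} (hf : LeadAt f a 0 c) :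
    AnalyticAt ℂ (TorusALia.reg f) a := by
  have h1 := eventually_reg_eq hf.meromorphicAt
  have h2 := hf.reg_eq
  obtain ⟨u, hu, rfl, he⟩ := hf
  refine hu.congr ?_
  have : ∀ᶠ w in 𝓝[≠] a, u w = TorusALia.reg f w := by
    filter_upwards [h1, he] with w h3 h4
    simp [h3, h4]
  rw [eventually_nhdsWithin_iff] at this
  filter_upwards [this] with w hw
  by_cases hwa : w = a
  · rw [hwa, h2]
  · exact hw hwa

theorem reg_comp_add (f : ℂ → ℂ) (b z : ℂ) : reg (fun w => f (w + b)) z = reg f (z + b) := by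
  have h : map (fun w : ℂ => w + b) (𝓝[≠] z) = 𝓝[≠] (z + b) := by
    exact (Homeomorph.addRight b).map_punctured_nhds_eq z
  rw [reg, reg, limUnder, limUnder, ← h, map_map]
  rfl

theorem reg_comp_neg (f : ℂ → ℂ) (z : ℂ) : reg (fun w => f (-w)) z = reg f (-z) := by
  have h : map (fun w : ℂ => -w) (𝓝[≠] z) = 𝓝[≠] (-z) := by
    exact (Homeomorph.neg ℂ).map_punctured_nhds_eq z
  rw [reg, reg, limUnder, limUnder, ← h, map_map]
  rfl

/-! ### Elliptic functions -/

/-- The identity theorem: local vanishing propagates over the connected plane. It turns local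
vanishing into a contradiction with a known pole. -/
theorem leadAt_eq_zero_of_eventually {f : ℂ → ℂ} (hf : ∀ z, MeromorphicAt f z) {a b c : ℂ} {n : ℤ}
    (hb : ∀ᶠ w in 𝓝[≠] b, f w = 0) (h : LeadAt f a n c) : c = 0 := by
  refine h.eq_zero ?_
  by_contra hne
  rw [← meromorphicOrderAt_eq_top_iff] at hb hne
  exact MeromorphicOn.meromorphicOrderAt_ne_top_of_isPreconnected (U := univ) (y := b)
    (fun z _ => hf z) isPreconnected_univ (mem_univ a) (mem_univ _) hne hb

theorem eventually_notMem_lattice (L : PeriodPair) (a : ℂ) : ∀ᶠ w in 𝓝[≠] a, w ∉ L.lattice := by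
  filter_upwards [mem_nhdsWithin_of_mem_nhds (L.compl_lattice_sdiff_singleton_mem_nhds a),
    self_mem_nhdsWithin] with w h1 h2 h3
  exact h1 ⟨h3, h2⟩

/-- The function `f` on `ℂ` is periodic with respect to the lattice of `L`. -/
def Per (L : PeriodPair) (f : ℂ → ℂ) : Prop := ∀ l ∈ L.lattice, ∀ z, f (z + l) = f z

namespace Per

variable {L : PeriodPair} {f : ℂ → ℂ}

theorem leadAt (hf : Per L f) {a l c : ℂ} {n : ℤ} (hl : l ∈ L.lattice) (h : LeadAt f a n c) :
    LeadAt f (a + l) n c := by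
  simpa [sub_neg_eq_add] using (h.comp_add (-l)).congr
    (Eventually.of_forall fun w => (hf _ (neg_mem hl) w).symm)

theorem reg (hf : Per L f) : Per L (reg f) := fun l hl z => by
  rw [← reg_comp_add]
  congr 1
  exact funext fun w => hf l hl w

/-- A holomorphic elliptic function is constant. -/
theorem liouville (hf : Per L f) (h : ∀ a, ∃ c, LeadAt f a 0 c) :
    ∃ c, ∀ z, TorusALia.reg f z = c := by
  have hd : Differentiable ℂ (TorusALia.reg f) := fun z => by
    obtain ⟨c, hc⟩ := h z
    exact hc.analyticAt_reg.differentiableAt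
  refine ⟨TorusALia.reg f 0, fun z => ?_⟩
  exact hd.apply_eq_apply_of_bounded (IsZLattice.isCompact_range_of_periodic L.lattice _
    hd.continuous fun z w hw => hf.reg w hw z).isBounded z 0

/-- An elliptic function cannot have only a simple pole modulo periods. -/
theorem residue_eq_zero (hf : Per L f) (ha : ∀ a ∉ L.lattice, AnalyticAt ℂ f a) {c : ℂ}
    (h0 : LeadAt f 0 (-1) c) : c = 0 := by
  by_contra hc
  -- The simple poles of `f z` and `f (-z)` cancel, so Liouville's theorem applies to the sum.
  obtain ⟨d, hd⟩ : ∃ d, ∀ z ∉ L.lattice, f z + f (-z) = d := by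
    have hper : Per L fun z => f z + f (-z) := fun l hl z => by
      simp only [hf l hl, neg_add, hf _ (neg_mem hl)]
    have han : ∀ a ∉ L.lattice, AnalyticAt ℂ (fun z => f z + f (-z)) a := fun a hal =>
      (ha a hal).add (AnalyticAt.fun_comp (f := fun z => -z)
        (ha _ fun h => hal (by simpa using neg_mem h)) analyticAt_id.neg)
    have hl0 : ∃ c, LeadAt (fun z => f z + f (-z)) 0 0 c := by
      have h1 : LeadAt (fun z => f (-z)) 0 (-1) (-c) := by simpa using h0.comp_neg
      have h2 := h0.add h1
      rw [add_neg_cancel] at h2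
      simpa using h2.succ
    obtain ⟨d, hd⟩ := hper.liouville fun a => by
      by_cases hal : a ∈ L.lattice
      · obtain ⟨c, hc⟩ := hl0
        exact ⟨c, by simpa using hper.leadAt hal hc⟩
      · exact ⟨_, (han a hal).leadAt⟩
    exact ⟨d, fun z hz => by rw [← hd z, reg_eq_of_continuousAt (han z hz).continuousAt]⟩
  -- This makes `g` odd off the lattice, so by periodicity it vanishes at every half-period that is
  -- not a period.
  set g : ℂ → ℂ := fun z => f z - d / 2 with hg
  have hgp : Per L g := fun l hl z => by simp only [hg, hf l hl]
  have hga : ∀ a ∉ L.lattice, AnalyticAt ℂ g a := fun a hal => (ha a hal).sub analyticAt_const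
  have hg0 : LeadAt g 0 (-1) c := by
    simpa using h0.sub ((LeadAt.const (a := 0) (d / 2)).lower_le (m := -1) (by norm_num))
  have hgl : ∀ a ∈ L.lattice, LeadAt g a (-1) c := fun a hal => by simpa using hgp.leadAt hal hg0
  have hgz : ∀ w ∈ L.lattice, w / 2 ∉ L.lattice → g (w / 2) = 0 := fun w hw hw2 => by
    have h1 := hd _ hw2
    have h2 := hf w hw (-(w / 2))
    have h3 : -(w / 2) + w = w / 2 := by ring
    rw [h3] at h2
    rw [← h2] at h1
    simp only [hg]
    linear_combination h1 / 2
  have z1 := hgz _ L.ω₁_mem_lattice L.ω₁_div_two_notMem_lattice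
  have z2 := hgz _ L.ω₂_mem_lattice L.ω₂_div_two_notMem_lattice
  set w := L.ω₁ / 2 with hw
  have hw2 : w + w ∈ L.lattice := by rw [hw, add_halves]; exact L.ω₁_mem_lattice
  have hwn := L.ω₁_div_two_notMem_lattice
  rw [← hw] at hwn
  have hsh : ∀ a, a + w ∉ L.lattice → AnalyticAt ℂ (fun z => g (z + w)) a := fun a h =>
    AnalyticAt.fun_comp (f := fun z => z + w) (hga _ h) (analyticAt_id.add analyticAt_const)
  -- In the product of `g` with its translate by the half-period `w`, every pole of one factor meets
  -- a zero of the other. The product is therefore constant, and its value at `ω₂ / 2` is `0`.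
  have hkp : Per L fun z => g z * g (z + w) := fun l hl z => by
    simp only [hgp l hl, add_right_comm z l w]
  have hk : ∀ a, ∃ c, LeadAt (fun z => g z * g (z + w)) a 0 c := fun a => by
    by_cases h1 : a ∈ L.lattice
    · have h2 : a + w ∉ L.lattice := fun h => hwn (by simpa using sub_mem h h1)
      have h3 := (hsh a h2).leadAt
      rw [add_comm a w, hgp a h1, z1] at h3
      exact (hgl a h1).mul_zero_one h3
    · by_cases h2 : a + w ∈ L.lattice
      · have h3 := (hga a h1).leadAt
        have h4 : a = w + ((a + w) - (w + w)) := by ring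
        have h5 : g a = 0 := by rw [h4, hgp _ (sub_mem h2 hw2), z1]
        rw [h5] at h3
        have h6 := (hgl _ h2).comp_add w
        rw [add_sub_cancel_right] at h6
        obtain ⟨e, he⟩ := h6.mul_zero_one h3
        exact ⟨e, he.congr (Eventually.of_forall fun z => mul_comm _ _)⟩
      · exact ⟨_, ((hga a h1).mul (hsh a h2)).leadAt⟩
  obtain ⟨k, hk⟩ := hkp.liouville hk
  have hk0 : k = 0 := by
    have h1 : L.ω₂ / 2 + w ∉ L.lattice := by
      have := (L.mul_ω₁_add_mul_ω₂_mem_lattice (α := 1 / 2) (β := 1 / 2)).not.mpr (by norm_num)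
      convert this using 2
      push_cast
      rw [hw]
      ring
    have h2 := hk (L.ω₂ / 2)
    rw [reg_eq_of_continuousAt
      ((hga _ L.ω₂_div_two_notMem_lattice).fun_mul (hsh _ h1)).continuousAt, z2,
      zero_mul] at h2
    exact h2.symm
  -- Near its pole `0` the factor `g z` is nonzero, so the translate vanishes there, hence
  -- everywhere, against its own pole.
  have hz : ∀ᶠ z in 𝓝[≠] (0 : ℂ), g (z + w) = 0 := by
    have hsh0 := (hsh 0 (by rwa [zero_add])).leadAt
    filter_upwards [hg0.eventually_ne_zero hc,
      eventually_reg_eq (hg0.mul hsh0).meromorphicAt] with z h1 h2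
    rw [hk, hk0] at h2
    exact (mul_eq_zero.1 h2.symm).resolve_left h1
  have hm : ∀ z, MeromorphicAt (fun z => g (z + w)) z := fun z => by
    by_cases h : z + w ∈ L.lattice
    · simpa using ((hgl _ h).comp_add w).meromorphicAt
    · exact (hsh z h).meromorphicAt
  exact hc (leadAt_eq_zero_of_eventually hm hz (hg0.comp_add w))

/-- The tool for proving identities between elliptic functions: once the pole at `0` is reduced to
order one, the difference is a constant. -/
theorem eq_const (hf : Per L f) (ha : ∀ a ∉ L.lattice, AnalyticAt ℂ f a) {c : ℂ}
    (h0 : LeadAt f 0 (-1) c) : ∃ k, ∀ z ∉ L.lattice, f z = k := by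
  obtain rfl := hf.residue_eq_zero ha h0
  obtain ⟨c, hc⟩ := h0.succ
  obtain ⟨k, hk⟩ := hf.liouville fun a => by
    by_cases hal : a ∈ L.lattice
    · exact ⟨c, by simpa using hf.leadAt hal hc⟩
    · exact ⟨_, (ha a hal).leadAt⟩
  exact ⟨k, fun z hz => by rw [← hk z, reg_eq_of_continuousAt (ha z hz).continuousAt]⟩

end Per

/-! ### Values and critical points of `℘`. -/

section Weierstrass

variable (L : PeriodPair)

theorem leadAt_weierstrassP {l : ℂ} (hl : l ∈ L.lattice) : LeadAt L.weierstrassP l (-2) 1 := by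
  have h : AnalyticAt ℂ (L.weierstrassPExcept l) l := L.analyticAt_weierstrassPExcept l
  refine ⟨fun z => (z - l) ^ 2 * L.weierstrassPExcept l z + 1 - (z - l) ^ 2 * (l ^ 2)⁻¹,
    by fun_prop, by simp, ?_⟩
  filter_upwards [self_mem_nhdsWithin] with z (hz : _ ≠ _)
  have h2 : (z - l) ^ 2 ≠ 0 := by simpa [sub_eq_zero] using hz
  have h3 := L.ite_eq_one_sub_sq_mul_weierstrassP l hl z
  rw [if_neg hz, div_eq_mul_inv] at h3
  rw [← h3, zpow_neg]
  exact (inv_mul_cancel_left₀ h2 _).symm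

theorem leadAt_derivWeierstrassP {l : ℂ} (hl : l ∈ L.lattice) :
    LeadAt L.derivWeierstrassP l (-3) (-2) := by
  have := (leadAt_weierstrassP L hl).deriv
  rw [L.deriv_weierstrassP] at this
  norm_num at this
  exact this

theorem per_weierstrassP : Per L L.weierstrassP := fun l hl z => L.weierstrassP_add_coe z ⟨l, hl⟩

theorem per_derivWeierstrassP : Per L L.derivWeierstrassP :=
  fun l hl z => L.derivWeierstrassP_add_coe z ⟨l, hl⟩

variable {L}

/-- On the left the double poles at `±w` are cancelled by the squared zero of `℘ - ℘(w)`, and the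
pole of order four at `0` drops to three since the difference vanishes there. Subtracting a multiple
of `℘'` leaves an odd function with at most a double pole; oddness excludes the double pole, and an
odd constant is zero. Comparing orders of vanishing in this identity yields the two facts about `℘`
used later. -/
theorem exists_sq_mul_eq_derivWeierstrassP {w : ℂ} (hw : 2 * w ∉ L.lattice) :
    ∃ k, k ≠ 0 ∧ ∀ z, ∀ᶠ x in 𝓝[≠] z, (L.weierstrassP x - L.weierstrassP w) ^ 2 *
      (L.weierstrassP (x - w) - L.weierstrassP (x + w)) = k * L.derivWeierstrassP x := by
  have hw1 : w ∉ L.lattice := fun h => hw (by rw [two_mul]; exact add_mem h h)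
  set Q : ℂ → ℂ := fun z => L.weierstrassP z - L.weierstrassP w with hQ
  set D : ℂ → ℂ := fun z => L.weierstrassP (z - w) - L.weierstrassP (z + w) with hD
  set F : ℂ → ℂ := fun z => Q z ^ 2 * D z with hF
  have hQp : Per L Q := fun l hl z => by simp only [hQ, per_weierstrassP L l hl]
  have hDp : Per L D := fun l hl z => by
    simp only [hD, add_right_comm z l w, add_sub_right_comm z l w, per_weierstrassP L l hl]
  have hFp : Per L F := fun l hl z => by simp only [hF, hQp l hl, hDp l hl]
  have hQn : ∀ z, Q (-z) = Q z := fun z => by simp only [hQ, L.weierstrassP_neg]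
  have hDn : ∀ z, D (-z) = - D z := fun z => by
    simp only [hD]
    rw [← L.weierstrassP_neg (-z - w), ← L.weierstrassP_neg (-z + w)]
    ring_nf
  have hFn : ∀ z, F (-z) = - F z := fun z => by simp only [hF, hQn, hDn]; ring
  have hQa : ∀ a ∉ L.lattice, AnalyticAt ℂ Q a := fun a h =>
    (L.analyticOnNhd_weierstrassP a h).sub analyticAt_const
  have hm : ∀ a, a - w ∉ L.lattice → AnalyticAt ℂ (fun z => L.weierstrassP (z - w)) a :=
    fun a h => AnalyticAt.fun_comp (f := fun z => z - w) (L.analyticOnNhd_weierstrassP _ h)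
      (analyticAt_id.sub analyticAt_const)
  have hp : ∀ a, a + w ∉ L.lattice → AnalyticAt ℂ (fun z => L.weierstrassP (z + w)) a :=
    fun a h => AnalyticAt.fun_comp (f := fun z => z + w) (L.analyticOnNhd_weierstrassP _ h)
      (analyticAt_id.add analyticAt_const)
  have hpm : ∀ a, a - w ∈ L.lattice → a + w ∉ L.lattice := fun a h1 h2 =>
    hw (by convert sub_mem h2 h1 using 1; ring)
  have hDw : ∀ a, a - w ∈ L.lattice → LeadAt D a (-2) 1 := fun a h => by
    have h1 := (leadAt_weierstrassP L h).comp_add (-w)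
    rw [sub_neg_eq_add, sub_add_cancel] at h1
    have h2 := (hp a (hpm a h)).leadAt.lower_le (m := -2) (by norm_num)
    simpa [sub_eq_add_neg, hD] using h1.sub h2
  have hFw : ∀ a, a - w ∈ L.lattice → ∃ c, LeadAt F a 0 c := fun a h => by
    have h1 : a ∉ L.lattice := fun h1 => hw1 (by simpa using sub_mem h1 h)
    have h2 : Q a = 0 := by
      have := per_weierstrassP L _ h w
      rw [add_sub_cancel] at this
      simp only [hQ, this, sub_self]
    have h3 := (hQa a h1).leadAt
    rw [h2] at h3
    obtain ⟨c, hc⟩ := h3.succ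
    exact ⟨_, by simpa using (hc.pow 2).mul (hDw a h)⟩
  have hF0 : ∀ a ∉ L.lattice, ∃ c, LeadAt F a 0 c := fun a ha => by
    by_cases h1 : a - w ∈ L.lattice
    · exact hFw a h1
    by_cases h2 : a + w ∈ L.lattice
    · obtain ⟨c, hc⟩ := hFw (-a) (by rw [← neg_mem_iff]; simpa [add_comm] using h2)
      exact ⟨-c, ((by simpa using hc.comp_neg : LeadAt (fun z => F (-z)) a 0 c)).neg.congr
        (Eventually.of_forall fun z => by rw [hFn, neg_neg])⟩
    · exact ⟨_, (((hQa a ha).pow 2).mul ((hm a h1).sub (hp a h2))).leadAt⟩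
  obtain ⟨d, hd⟩ : ∃ d, LeadAt F 0 (-3) d := by
    have h1 : LeadAt Q 0 (-2) 1 := by
      simpa using (leadAt_weierstrassP L (zero_mem _)).sub
        ((LeadAt.const (L.weierstrassP w)).lower_le (m := -2) (by norm_num))
    have h2 : LeadAt D 0 0 (D 0) :=
      ((hm 0 (by simpa using hw1)).sub (hp 0 (by simpa using hw1))).leadAt
    have h3 : D 0 = 0 := by simp [hD, L.weierstrassP_neg]
    rw [h3] at h2
    obtain ⟨c, hc⟩ := h2.succ
    exact ⟨_, by simpa using (h1.pow 2).mul hc⟩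
  set G : ℂ → ℂ := fun z => reg F z - (-d / 2) * L.derivWeierstrassP z with hG
  have hGp : Per L G := fun l hl z => by
    simp only [hG, hFp.reg l hl, per_derivWeierstrassP L l hl]
  have hGa : ∀ a ∉ L.lattice, AnalyticAt ℂ G a := fun a ha => by
    obtain ⟨c, hc⟩ := hF0 a ha
    exact hc.analyticAt_reg.sub (analyticAt_const.mul (L.analyticOnNhd_derivWeierstrassP a ha))
  have hrn : ∀ z ∉ L.lattice, reg F (-z) = - reg F z := fun z hz => by
    obtain ⟨c, hc⟩ := hF0 z hz
    rw [← reg_comp_neg, funext hFn, hc.reg_eq, hc.neg.reg_eq]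
  have hGn : ∀ z ∉ L.lattice, G (-z) = - G z := fun z hz => by
    simp only [hG, hrn z hz, L.derivWeierstrassP_neg]
    ring
  obtain ⟨e, he⟩ : ∃ e, LeadAt G 0 (-2) e := by
    have := hd.reg.sub ((leadAt_derivWeierstrassP L (zero_mem _)).const_mul (-d / 2))
    have h2 : d - -d / 2 * -2 = 0 := by ring
    rw [h2] at this
    simpa using this.succ
  -- An odd function has no leading term of even order.
  have he0 : e = 0 := by
    have h1 : LeadAt (fun z => G (-z)) 0 (-2) e := by simpa using he.comp_neg
    have h2 := (h1.congr (g := fun z => - G z) (by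
      filter_upwards [eventually_notMem_lattice L 0] with z hz
      rw [hGn z hz])).unique he.neg
    linear_combination h2 / 2
  rw [he0] at he
  obtain ⟨e, he⟩ := he.succ
  obtain ⟨k, hk⟩ := hGp.eq_const hGa he
  have hk0 : k = 0 := by
    have h1 := hk w hw1
    have h2 := hk (-w) (fun h => hw1 (by simpa using neg_mem h))
    rw [hGn w hw1, h1] at h2
    linear_combination -h2 / 2
  have hFm : ∀ z, MeromorphicAt F z := fun z => by
    by_cases h : z ∈ L.lattice
    · exact (by simpa using hFp.leadAt h hd : LeadAt F z (-3) d).meromorphicAt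
    · obtain ⟨c, hc⟩ := hF0 z h
      exact hc.meromorphicAt
  have hFe : ∀ z, ∀ᶠ x in 𝓝[≠] z, F x = (-d / 2) * L.derivWeierstrassP x := fun z => by
    filter_upwards [eventually_reg_eq (hFm z), eventually_notMem_lattice L z] with x h1 h2
    have h3 := hk x h2
    rw [hk0] at h3
    rw [← h1]
    exact sub_eq_zero.1 h3
  -- If the constant were `0`, then near `w`, where `D` has a pole, `Q` would vanish, and so it
  -- would vanish identically.
  refine ⟨-d / 2, fun hd0 => ?_, hFe⟩
  have hz : ∀ᶠ x in 𝓝[≠] w, Q x = 0 := by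
    filter_upwards [hFe w, (hDw w (by simp)).eventually_ne_zero one_ne_zero] with x h1 h2
    rw [hd0, zero_mul] at h1
    exact pow_eq_zero_iff two_ne_zero |>.1 ((mul_eq_zero.1 h1).resolve_right h2)
  have hQm : ∀ z, MeromorphicAt Q z := fun z =>
    (L.meromorphic_weierstrassP z).sub (MeromorphicAt.const _ _)
  have h1 : LeadAt Q 0 (-2) 1 := by
    simpa using (leadAt_weierstrassP L (zero_mem _)).sub
      ((LeadAt.const (L.weierstrassP w)).lower_le (m := -2) (by norm_num))
  exact one_ne_zero (leadAt_eq_zero_of_eventually hQm hz h1)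

theorem exists_leadAt_weierstrassP_sub (w : ℂ) {a : ℂ} (ha : a ∉ L.lattice) :
    ∃ (m : ℕ) (c : ℂ), c ≠ 0 ∧ LeadAt (fun z => L.weierstrassP z - L.weierstrassP w) a m c := by
  refine exists_leadAt_ne_zero ((L.analyticOnNhd_weierstrassP a ha).sub analyticAt_const) ?_
  intro h
  have h1 : LeadAt (fun z => L.weierstrassP z - L.weierstrassP w) 0 (-2) 1 := by
    simpa using (leadAt_weierstrassP L (zero_mem _)).sub
      ((LeadAt.const (L.weierstrassP w)).lower_le (m := -2) (by norm_num))
  exact one_ne_zero (leadAt_eq_zero_of_eventually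
    (fun z => (L.meromorphic_weierstrassP z).sub (MeromorphicAt.const _ _))
    (h.filter_mono nhdsWithin_le_nhds) h1)

theorem leadAt_derivWeierstrassP_of_sub {w a c : ℂ} {m : ℤ}
    (h : LeadAt (fun z => L.weierstrassP z - L.weierstrassP w) a m c) :
    LeadAt L.derivWeierstrassP a (m - 1) (m * c) := by
  have := h.deriv
  rwa [deriv_sub_const_fun, L.deriv_weierstrassP] at this

/-- If `℘ - ℘(w)` vanished at `w` to order `m ≥ 2`, the left side of the preceding identity would
have order `2m - 2` there, more than the order `m - 1` of `℘'`. -/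
theorem derivWeierstrassP_ne_zero {w : ℂ} (hw : 2 * w ∉ L.lattice) :
    L.derivWeierstrassP w ≠ 0 := by
  intro h0
  have hw1 : w ∉ L.lattice := fun h => hw (by rw [two_mul]; exact add_mem h h)
  obtain ⟨k, hk, he⟩ := exists_sq_mul_eq_derivWeierstrassP hw
  obtain ⟨m, c, hc, hm⟩ := exists_leadAt_weierstrassP_sub (L := L) w hw1
  have hd := leadAt_derivWeierstrassP_of_sub hm
  have hm0 : m ≠ 0 := fun h => by
    subst h
    have := ((L.analyticOnNhd_weierstrassP w hw1).fun_sub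
      (analyticAt_const (v := L.weierstrassP w))).leadAt
    exact hc (hm.unique (by simpa using this))
  have hm1 : m ≠ 1 := fun h => by
    subst h
    have h1 := (L.analyticOnNhd_derivWeierstrassP w hw1).leadAt
    rw [h0] at h1
    norm_num at hd
    exact hc (hd.unique h1)
  have h1 : LeadAt (fun z => L.weierstrassP (z - w) - L.weierstrassP (z + w)) w (-2) 1 := by
    have h1 := (leadAt_weierstrassP L (zero_mem _)).comp_add (-w)
    rw [sub_neg_eq_add, zero_add] at h1
    have h2 : AnalyticAt ℂ (fun z => L.weierstrassP (z + w)) w :=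
      AnalyticAt.fun_comp (f := fun z => z + w)
        (L.analyticOnNhd_weierstrassP _ (by rwa [← two_mul])) (analyticAt_id.add analyticAt_const)
    simpa [sub_eq_add_neg] using h1.sub (h2.leadAt.lower_le (m := -2) (by norm_num))
  have h2 := ((hm.pow 2).mul h1).congr (g := fun x => k * L.derivWeierstrassP x)
    (by filter_upwards [he w] with x hx; exact hx.symm)
  have h3 := (hd.const_mul k).unique (h2.lower_le (m := m - 1) (by push_cast; omega))
  simp [hk, hc, hm0] at h3

/-- At a zero `z` of order `m` other than `±w` modulo periods, the left side of the identity has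
order at least `2m`, but `℘'` has order `m - 1`. -/
theorem weierstrassP_eq_iff {w z : ℂ} (hw : 2 * w ∉ L.lattice) (hz : z ∉ L.lattice)
    (h : L.weierstrassP z = L.weierstrassP w) : z - w ∈ L.lattice ∨ z + w ∈ L.lattice := by
  by_contra! hne
  obtain ⟨k, hk, he⟩ := exists_sq_mul_eq_derivWeierstrassP hw
  obtain ⟨m, c, hc, hm⟩ := exists_leadAt_weierstrassP_sub (L := L) w hz
  have hd := leadAt_derivWeierstrassP_of_sub hm
  have hm0 : m ≠ 0 := fun h' => by
    subst h'
    have := ((L.analyticOnNhd_weierstrassP z hz).fun_sub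
      (analyticAt_const (v := L.weierstrassP w))).leadAt
    exact hc (hm.unique (by simpa [h] using this))
  have h1 : AnalyticAt ℂ (fun x => L.weierstrassP (x - w) - L.weierstrassP (x + w)) z :=
    (AnalyticAt.fun_comp (f := fun z => z - w) (L.analyticOnNhd_weierstrassP _ hne.1)
      (analyticAt_id.sub analyticAt_const)).sub
    (AnalyticAt.fun_comp (f := fun z => z + w) (L.analyticOnNhd_weierstrassP _ hne.2)
      (analyticAt_id.add analyticAt_const))
  have h2 := ((hm.pow 2).mul h1.leadAt).congr (g := fun x => k * L.derivWeierstrassP x)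
    (by filter_upwards [he z] with x hx; exact hx.symm)
  have h3 := (hd.const_mul k).unique (h2.lower_le (m := m - 1) (by push_cast; omega))
  simp [hk, hc, hm0] at h3

end Weierstrass

/-! ### Roots of unity -/

theorem omega_add (M : ℕ) (j k : ℤ) : omega M (j + k) = omega M j * omega M k := by
  rw [omega, omega, omega, ← Complex.exp_add]
  congr 1
  push_cast
  ring

theorem omega_zero (M : ℕ) : omega M 0 = 1 := by simp [omega]

theorem omega_ne_zero (M : ℕ) (j : ℤ) : omega M j ≠ 0 := Complex.exp_ne_zero _

theorem omega_eq_one_iff {M : ℕ} (hM : M ≠ 0) (j : ℤ) : omega M j = 1 ↔ (M : ℤ) ∣ j := by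
  have hM' : (M : ℂ) ≠ 0 := Nat.cast_ne_zero.2 hM
  have hpi : (2 * Real.pi * Complex.I : ℂ) ≠ 0 := Complex.two_pi_I_ne_zero
  rw [omega, Complex.exp_eq_one_iff]
  constructor
  · rintro ⟨n, hn⟩
    refine ⟨n, ?_⟩
    rw [mul_div_assoc, mul_comm (n : ℂ)] at hn
    have := mul_left_cancel₀ hpi hn
    rw [div_eq_iff hM'] at this
    rw [mul_comm]
    exact_mod_cast this
  · rintro ⟨n, rfl⟩
    refine ⟨n, ?_⟩
    push_cast
    field_simp

/-! ### Sums over a period -/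

section Period

variable {M : ℕ} {H : ℤ → ℂ}

theorem sum_range_add_one (hH : ∀ k, H (k + M) = H k) :
    ∑ k ∈ Finset.range M, H (k + 1) = ∑ k ∈ Finset.range M, H k := by
  have h1 := Finset.sum_range_succ (fun k : ℕ => H k) M
  have h2 := Finset.sum_range_succ' (fun k : ℕ => H k) M
  rw [h1] at h2
  have h3 := hH 0
  push_cast at h2
  rw [zero_add] at h3
  rw [h3] at h2
  exact (add_right_cancel h2).symm

theorem sum_range_sub_one (hH : ∀ k, H (k + M) = H k) :
    ∑ k ∈ Finset.range M, H (k - 1) = ∑ k ∈ Finset.range M, H k := by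
  rw [← sum_range_add_one (H := fun k => H (k - 1)) fun k => by rw [← hH (k - 1)]; congr 1; ring]
  simp

theorem sum_range_neg (hH : ∀ k, H (k + M) = H k) :
    ∑ k ∈ Finset.range M, H (-k) = ∑ k ∈ Finset.range M, H k := by
  -- Reflection replaces `k` by `M - 1 - k`; the shift by one compensates for the `-1`.
  rw [← sum_range_add_one hH, ← Finset.sum_range_reflect]
  refine Finset.sum_congr rfl fun k hk => ?_
  have hk' := Finset.mem_range.1 hk
  rw [← hH, Nat.cast_sub (by omega), Nat.cast_sub (by omega)]
  congr 1
  push_cast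
  ring

end Period

theorem LeadAt.sum {ι : Type*} (s : Finset ι) {F : ι → ℂ → ℂ} {a : ℂ} {n : ℤ} {c : ι → ℂ}
    (h : ∀ i ∈ s, LeadAt (F i) a n (c i)) :
    LeadAt (fun z => ∑ i ∈ s, F i z) a n (∑ i ∈ s, c i) := by
  classical
  induction s using Finset.induction_on with
  | empty => exact ⟨0, analyticAt_const, rfl, by simp⟩
  | insert i s hi ih =>
    simp only [Finset.sum_insert hi]
    exact (h i (Finset.mem_insert_self i s)).add (ih fun k hk => h k (Finset.mem_insert_of_mem hk))

/-! ### The functions `P_j` -/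

/-- The class of `α` has order `M ≥ 3` in `ℂ / L`. -/
structure HasTorsion (L : PeriodPair) (M : ℕ) (α : ℂ) : Prop where
  three_le : 3 ≤ M
  mem_iff : ∀ k : ℤ, k * α ∈ L.lattice ↔ (M : ℤ) ∣ k

/-- `Λ` is the lattice generated by `L` and `α`. -/
def IsExtension (L : PeriodPair) (α : ℂ) (Λ : PeriodPair) : Prop :=
  ∀ z, z ∈ Λ.lattice ↔ ∃ k : ℤ, z - k * α ∈ L.lattice

/-- The summand of `P_j`. -/
def logP (L : PeriodPair) (α z : ℂ) : ℂ :=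
  L.derivWeierstrassP z / (L.weierstrassP z - L.weierstrassP α)

section P

variable {L Λ : PeriodPair} {M : ℕ} {α : ℂ} {j : ℤ}

theorem per_logP (L : PeriodPair) (α : ℂ) : Per L (logP L α) := fun l hl z => by
  rw [logP, logP, per_weierstrassP L l hl, per_derivWeierstrassP L l hl]

theorem logP_neg (z : ℂ) : logP L α (-z) = - logP L α z := by
  rw [logP, logP, L.weierstrassP_neg, L.derivWeierstrassP_neg, neg_div]

theorem analyticAt_logP (hα : 2 * α ∉ L.lattice) {z : ℂ} (h1 : z ∉ L.lattice)
    (h2 : z - α ∉ L.lattice) (h3 : z + α ∉ L.lattice) : AnalyticAt ℂ (logP L α) z :=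
  (L.analyticOnNhd_derivWeierstrassP z h1).div
    ((L.analyticOnNhd_weierstrassP z h1).sub analyticAt_const)
    (sub_ne_zero.2 fun h => (weierstrassP_eq_iff hα h1 h).elim h2 h3)

/-- As a logarithmic derivative of `℘ - ℘(α)`, the function `logP` has the orders of that function
as residues: `-2` at the double pole `0`, and `1` at the simple zeros `±α`. -/
theorem leadAt_logP_zero : LeadAt (logP L α) 0 (-1) (-2) := by
  have h1 : LeadAt (fun z => L.weierstrassP z - L.weierstrassP α) 0 (-2) 1 := by
    simpa using (leadAt_weierstrassP L (zero_mem _)).sub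
      ((LeadAt.const (L.weierstrassP α)).lower_le (m := -2) (by norm_num))
  have h2 := (leadAt_derivWeierstrassP L (zero_mem _)).div h1 one_ne_zero
  norm_num at h2
  exact h2

theorem leadAt_logP_self (hα : 2 * α ∉ L.lattice) : LeadAt (logP L α) α (-1) 1 := by
  have hα1 : α ∉ L.lattice := fun h => hα (by rw [two_mul]; exact add_mem h h)
  have h0 := derivWeierstrassP_ne_zero hα
  have h1 : LeadAt (fun z => L.weierstrassP z - L.weierstrassP α) α 0 0 := by
    simpa using ((L.analyticOnNhd_weierstrassP α hα1).fun_sub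
      (analyticAt_const (v := L.weierstrassP α))).leadAt
  have h2 := (L.analyticOnNhd_derivWeierstrassP α hα1).leadAt
  obtain ⟨c, hc⟩ := h1.succ
  have h3 := leadAt_derivWeierstrassP_of_sub hc
  norm_num at h3
  obtain rfl := h3.unique h2
  have := h2.div hc h0
  rw [div_self h0] at this
  norm_num at this
  exact this

theorem leadAt_logP_neg_self (hα : 2 * α ∉ L.lattice) : LeadAt (logP L α) (-α) (-1) 1 := by
  have h : LeadAt (fun z => logP L α (-z)) (-α) (-1) (-1) := by
    simpa using (leadAt_logP_self hα).comp_neg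
  simpa using h.neg.congr (g := logP L α) (Eventually.of_forall fun z => by rw [logP_neg, neg_neg])

namespace HasTorsion

theorem ne_zero (h : HasTorsion L M α) : M ≠ 0 := by have := h.three_le; omega

theorem two_mul_notMem (h : HasTorsion L M α) : 2 * α ∉ L.lattice := fun h2 => by
  have h3 := (h.mem_iff 2).1 (by exact_mod_cast h2)
  have h4 := Int.le_of_dvd (by norm_num) h3
  have := h.three_le
  omega

theorem mul_mem (h : HasTorsion L M α) : (M : ℂ) * α ∈ L.lattice := by
  have := (h.mem_iff M).2 (dvd_refl _)
  exact_mod_cast this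

end HasTorsion

theorem P_eq (L : PeriodPair) (M : ℕ) (α : ℂ) (j : ℤ) (z : ℂ) :
    P L M α j z = ∑ k ∈ Finset.range M, omega M (-(k * j)) * logP L α (z - k * α) := rfl

theorem per_P (L : PeriodPair) (M : ℕ) (α : ℂ) (j : ℤ) : Per L (P L M α j) := fun l hl z => by
  simp only [P_eq, add_sub_right_comm, per_logP L α l hl]

theorem omega_mul_logP_add (h : HasTorsion L M α) (j : ℤ) (z : ℂ) (k : ℤ) :
    omega M (-((k + M : ℤ) * j)) * logP L α (z - (k + M : ℤ) * α) =
      omega M (-(k * j)) * logP L α (z - k * α) := by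
  have h1 : -((k + M : ℤ) * j) = -(k * j) + M * (-j) := by ring
  have h2 : z - ((k + M : ℤ) : ℂ) * α = z - k * α + -(M * α) := by push_cast; ring
  rw [h1, omega_add, (omega_eq_one_iff h.ne_zero _).2 (dvd_mul_right _ _), mul_one, h2,
    per_logP L α _ (neg_mem h.mul_mem)]

/-- Translation by `α` permutes the summands cyclically; up to a factor, `P_j` projects `logP` to
one eigenspace of this translation. -/
theorem P_add_self (h : HasTorsion L M α) (j : ℤ) (z : ℂ) :
    P L M α j (z + α) = omega M (-j) * P L M α j z := by
  have h1 := sum_range_sub_one (H := fun k : ℤ => omega M (-(k * j)) * logP L α (z - k * α))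
    (omega_mul_logP_add h j z)
  simp only [Int.cast_natCast] at h1
  rw [P_eq, P_eq, ← h1, Finset.mul_sum]
  refine Finset.sum_congr rfl fun k _ => ?_
  rw [← mul_assoc, ← omega_add]
  congr 2
  · ring
  · push_cast
    ring

theorem P_add_int (h : HasTorsion L M α) (j : ℤ) (k : ℤ) (z : ℂ) :
    P L M α j (z + k * α) = omega M (-(k * j)) * P L M α j z := by
  induction k using Int.induction_on generalizing z with
  | zero => simp [omega_zero]
  | succ k ih =>
    have h1 : z + ((k + 1 : ℤ) : ℂ) * α = z + (k : ℤ) * α + α := by push_cast; ring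
    rw [h1, P_add_self h, ih, ← mul_assoc, ← omega_add]
    congr 2
    ring
  | pred k ih =>
    have h1 : z + ((-k : ℤ) : ℂ) * α = z + ((-k - 1 : ℤ) : ℂ) * α + α := by push_cast; ring
    have h2 := ih z
    rw [h1, P_add_self h] at h2
    have h3 : omega M j * omega M (-j) = 1 := by rw [← omega_add, add_neg_cancel, omega_zero]
    have h4 : (-((-k - 1 : ℤ) * j)) = j + -(-k * j) := by ring
    rw [h4, omega_add, mul_assoc, ← h2, ← mul_assoc, h3, one_mul]

theorem P_neg (h : HasTorsion L M α) (j : ℤ) (z : ℂ) :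
    P L M α j (-z) = - P L M α (-j) z := by
  have h1 := sum_range_neg (H := fun k : ℤ => omega M (-(k * -j)) * logP L α (z - k * α))
    (omega_mul_logP_add h (-j) z)
  simp only [Int.cast_natCast] at h1
  rw [P_eq, P_eq, ← h1, ← Finset.sum_neg_distrib]
  refine Finset.sum_congr rfl fun k _ => ?_
  have h2 : -z - (k : ℂ) * α = -(z - ((-k : ℤ) : ℂ) * α) := by push_cast; ring
  have h3 : -((k : ℤ) * j) = -(-(k : ℤ) * -j) := by ring
  rw [h2, h3, logP_neg, mul_neg]

theorem analyticAt_P (h : HasTorsion L M α) (hΛ : IsExtension L α Λ) (j : ℤ) {z : ℂ}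
    (hz : z ∉ Λ.lattice) : AnalyticAt ℂ (P L M α j) z := by
  have hn : ∀ k : ℤ, z - k * α ∉ L.lattice := fun k hk => hz ((hΛ z).2 ⟨k, hk⟩)
  refine Finset.analyticAt_fun_sum _ fun k _ => analyticAt_const.mul ?_
  refine AnalyticAt.fun_comp (f := fun z => z - k * α) (analyticAt_logP h.two_mul_notMem ?_ ?_ ?_)
    (analyticAt_id.sub analyticAt_const)
  · exact_mod_cast hn k
  · convert hn (k + 1) using 2
    push_cast
    ring
  · convert hn (k - 1) using 2
    push_cast
    ring

/-- Only the summands `k = 0, 1, M - 1` have a pole at `0`, since there the argument is `0`, `-α` or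
`α` modulo periods. The three indices are distinct because `M ≥ 3`. -/
theorem leadAt_P_zero (h : HasTorsion L M α) (j : ℤ) :
    LeadAt (P L M α j) 0 (-1) (omega M (-j) + omega M j - 2) := by
  have hM := h.three_le
  have hα := h.two_mul_notMem
  have key : ∀ k ∈ Finset.range M, LeadAt (fun z => omega M (-(k * j)) * logP L α (z - k * α)) 0
      (-1) (omega M (-(k * j)) * ((if k = 0 then -2 else 0) + (if k = 1 then 1 else 0) +
        (if k = M - 1 then 1 else 0))) := fun k hk => by
    have hk' := Finset.mem_range.1 hk
    refine LeadAt.const_mul ?_ _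
    suffices hs : LeadAt (logP L α) (-(k * α)) (-1) ((if k = 0 then -2 else 0) +
        (if k = 1 then 1 else 0) + (if k = M - 1 then 1 else 0)) by
      simpa [sub_eq_add_neg] using hs.comp_add (-(k * α))
    by_cases h0 : k = 0
    · subst h0
      have h1 : ¬ (0 = M - 1) := by omega
      simpa [h1] using leadAt_logP_zero
    by_cases h1 : k = 1
    · subst h1
      have h2 : ¬ (1 = M - 1) := by omega
      simpa [h2] using leadAt_logP_neg_self hα
    by_cases h2 : k = M - 1
    · rw [if_neg h0, if_neg h1, if_pos h2, h2, Nat.cast_sub (by omega)]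
      have := (per_logP L α).leadAt (neg_mem h.mul_mem) (leadAt_logP_self hα)
      convert this using 1
      · push_cast
        ring
      · simp
    · rw [if_neg h0, if_neg h1, if_neg h2]
      have hn : ∀ i : ℤ, i ≠ 0 → -M < i → i < M → i * α ∉ L.lattice := fun i hi h3 h4 h5 => by
        obtain ⟨e, he⟩ := (h.mem_iff i).1 h5
        have h6 : -1 < e := by nlinarith
        have h7 : e < 1 := by nlinarith
        obtain rfl : e = 0 := by omega
        exact hi (by simpa using he)
      have := (analyticAt_logP hα (z := -(k * α))
        (by convert hn (-k) (by omega) (by omega) (by omega) using 2; push_cast; ring)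
        (by
          convert hn (-(k + 1 : ℕ)) (by omega) (by omega) (by omega) using 2
          push_cast
          ring)
        (by
          convert hn (-((k : ℤ) - 1)) (by omega) (by omega) (by omega) using 2
          push_cast
          ring)).leadAt
      simpa using this.lower_le (m := -1) (by norm_num)
  have hs : LeadAt (P L M α j) 0 (-1) _ := LeadAt.sum _ key
  refine (congrArg (LeadAt (P L M α j) 0 (-1)) ?_).mp hs
  simp only [mul_add, Finset.sum_add_distrib, mul_ite, mul_zero, Finset.sum_ite_eq',
    Finset.mem_range]
  rw [if_pos (by omega), if_pos (by omega), if_pos (by omega), Nat.cast_sub (by omega)]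
  have h1 : -(((M : ℤ) - (1 : ℕ)) * j) = M * (-j) + j := by push_cast; ring
  rw [h1, omega_add, (omega_eq_one_iff h.ne_zero _).2 (dvd_mul_right _ _)]
  simp [omega_zero]
  ring

theorem omega_neg_add_omega_sub_two_ne_zero (hM : M ≠ 0) (hj : ¬ (M : ℤ) ∣ j) :
    omega M (-j) + omega M j - 2 ≠ 0 := by
  have h1 : omega M j - 1 ≠ 0 := sub_ne_zero.2 fun h => hj ((omega_eq_one_iff hM j).1 h)
  have h2 : omega M (-j) + omega M j - 2 = omega M (-j) * (omega M j - 1) ^ 2 := by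
    have h3 : omega M (-j) * omega M j = 1 := by rw [← omega_add, neg_add_cancel, omega_zero]
    linear_combination (-omega M j + 2) * h3
  rw [h2]
  exact mul_ne_zero (omega_ne_zero _ _) (pow_ne_zero 2 h1)

/-- One `k` serves all indices `i`, so the characters of products of different `P_i` can be
multiplied. -/
theorem exists_P_add_eq (h : HasTorsion L M α) (hΛ : IsExtension L α Λ) {l : ℂ}
    (hl : l ∈ Λ.lattice) : ∃ k : ℤ, ∀ i z, P L M α i (z + l) = omega M (-(k * i)) * P L M α i z := by
  obtain ⟨k, hk⟩ := (hΛ l).1 hl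
  refine ⟨k, fun i z => ?_⟩
  have h1 : z + l = z + k * α + (l - k * α) := by ring
  rw [h1, per_P L M α i _ hk, P_add_int h]

theorem exists_leadAt_P (h : HasTorsion L M α) (hΛ : IsExtension L α Λ) (j : ℤ) {l : ℂ}
    (hl : l ∈ Λ.lattice) : ∃ c, LeadAt (P L M α j) l (-1) c := by
  obtain ⟨k, hk⟩ := exists_P_add_eq h hΛ (neg_mem hl)
  have h1 := (leadAt_P_zero h j).comp_add (-l)
  simp only [hk] at h1
  have h2 := h1.const_mul (omega M (-(k * j)))⁻¹
  simp only [inv_mul_cancel_left₀ (omega_ne_zero _ _)] at h2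
  exact ⟨_, by simpa using h2⟩

theorem meromorphicAt_P (h : HasTorsion L M α) (hΛ : IsExtension L α Λ) (j : ℤ) (z : ℂ) :
    MeromorphicAt (P L M α j) z := by
  by_cases hz : z ∈ Λ.lattice
  · obtain ⟨c, hc⟩ := exists_leadAt_P h hΛ j hz
    exact hc.meromorphicAt
  · exact (analyticAt_P h hΛ j hz).meromorphicAt

theorem not_dvd_of_not_dvd_two_mul (hj : ¬ (M : ℤ) ∣ 2 * j) : ¬ (M : ℤ) ∣ j :=
  fun h => hj (h.mul_left 2)

/-- If both functions vanished at `w`, then `P_j` would vanish at `w` and `-w`, and `P_j(z) P_j(z +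
w)` would have no poles, hence be constant. Translation by `α` multiplies it by `ω^{-2j} ≠ 1`, so it
would be zero, against the pole of `P_j` at `0`. -/
theorem P_neg_ne_zero (h : HasTorsion L M α) (hΛ : IsExtension L α Λ) (hj : ¬ (M : ℤ) ∣ 2 * j)
    {w : ℂ} (hw : w ∉ Λ.lattice) (h0 : P L M α j w = 0) : P L M α (-j) w ≠ 0 := by
  intro h1
  have h2 : P L M α j (-w) = 0 := by rw [P_neg h, h1, neg_zero]
  have hsh : ∀ a, a + w ∉ Λ.lattice → AnalyticAt ℂ (fun z => P L M α j (z + w)) a := fun a ha =>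
    AnalyticAt.fun_comp (f := fun z => z + w) (analyticAt_P h hΛ j ha)
      (analyticAt_id.add analyticAt_const)
  have hper : Per L fun z => P L M α j z * P L M α j (z + w) := fun l hl z => by
    simp only [per_P L M α j l hl, add_right_comm z l w]
  have hk : ∀ a, ∃ c, LeadAt (fun z => P L M α j z * P L M α j (z + w)) a 0 c := fun a => by
    by_cases ha : a ∈ Λ.lattice
    · obtain ⟨c, hc⟩ := exists_leadAt_P h hΛ j ha
      have h3 := (hsh a fun h => hw (by simpa using sub_mem h ha)).leadAt
      obtain ⟨k, hk⟩ := exists_P_add_eq h hΛ ha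
      rw [add_comm a w, hk, h0, mul_zero] at h3
      exact hc.mul_zero_one h3
    · by_cases haw : a + w ∈ Λ.lattice
      · obtain ⟨c, hc⟩ := exists_leadAt_P h hΛ j haw
        have h3 := (analyticAt_P h hΛ j ha).leadAt
        obtain ⟨k, hk⟩ := exists_P_add_eq h hΛ haw
        have h4 : a = -w + (a + w) := by ring
        have h5 : P L M α j a = 0 := by rw [h4, hk, h2, mul_zero]
        rw [h5] at h3
        have h6 := hc.comp_add w
        rw [add_sub_cancel_right] at h6
        obtain ⟨e, he⟩ := h6.mul_zero_one h3
        exact ⟨e, he.congr (Eventually.of_forall fun z => mul_comm _ _)⟩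
      · exact ⟨_, ((analyticAt_P h hΛ j ha).mul (hsh a haw)).leadAt⟩
  obtain ⟨C, hC⟩ := hper.liouville hk
  have hC0 : C = 0 := by
    have h3 := reg_comp_add (fun z => P L M α j z * P L M α j (z + w)) α 0
    obtain ⟨c, hc⟩ := hk 0
    have h4 : (fun z => P L M α j (z + α) * P L M α j (z + α + w)) =
        fun z => omega M (-(2 * j)) * (P L M α j z * P L M α j (z + w)) := by
      funext z
      have h5 : -(2 * j) = -j + -j := by ring
      rw [add_right_comm, P_add_self h, P_add_self h, h5, omega_add]
      ring
    rw [h4, hC, (hc.const_mul _).reg_eq, ← hc.reg_eq, hC] at h3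
    have h6 : omega M (-(2 * j)) ≠ 1 := fun h7 =>
      hj (by simpa using (omega_eq_one_iff h.ne_zero _).1 h7)
    by_contra hne
    exact h6 (mul_right_cancel₀ hne (by rw [h3, one_mul]))
  have hc := leadAt_P_zero h j
  have hcne := omega_neg_add_omega_sub_two_ne_zero h.ne_zero (not_dvd_of_not_dvd_two_mul hj)
  have hz : ∀ᶠ z in 𝓝[≠] (0 : ℂ), P L M α j (z + w) = 0 := by
    filter_upwards [hc.eventually_ne_zero hcne,
      eventually_reg_eq (hc.mul (hsh 0 (by simpa using hw)).leadAt).meromorphicAt] with z h3 h4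
    rw [hC, hC0] at h4
    exact (mul_eq_zero.1 h4.symm).resolve_left h3
  have hm : ∀ z, MeromorphicAt (fun z => P L M α j (z + w)) z := fun z => by
    obtain ⟨n, c, hc⟩ := exists_leadAt (meromorphicAt_P h hΛ j (z + w))
    simpa using (hc.comp_add w).meromorphicAt
  exact hcne (leadAt_eq_zero_of_eventually hm hz (hc.comp_add w))

/-- The relation between the functions `P_j` behind the intertwiner. -/
theorem exists_P_relation (h : HasTorsion L M α) (hΛ : IsExtension L α Λ)
    (hj : ¬ (M : ℤ) ∣ 2 * j) : ∃ lam mu : ℂ, mu ≠ 0 ∧ ∀ z ∉ Λ.lattice,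
      P L M α (2 * j) z * P L M α (-j) z ^ 2 - P L M α (-2 * j) z * P L M α j z ^ 2 =
        lam * P L M α (-j) z * P L M α j z + mu := by
  have hj1 := not_dvd_of_not_dvd_two_mul hj
  have hres := fun {i : ℤ} (hi : ¬ (M : ℤ) ∣ i) =>
    omega_neg_add_omega_sub_two_ne_zero h.ne_zero hi
  have hrj := hres hj1
  have hrj' : omega M (- -j) + omega M (-j) - 2 ≠ 0 := hres (by simpa using hj1)
  have hr2 := hres hj
  have han := fun (i : ℤ) {z : ℂ} (hz : z ∉ Λ.lattice) => analyticAt_P h hΛ i hz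
  set G : ℂ → ℂ := fun z =>
    P L M α (2 * j) z * P L M α (-j) z ^ 2 - P L M α (-2 * j) z * P L M α j z ^ 2 with hG
  set K : ℂ → ℂ := fun z => P L M α (-j) z * P L M α j z with hK
  -- The characters of the three monomials are trivial, so `G` and `K` are periodic for `Λ` and not
  -- only for `L`.
  have hchar : ∀ k : ℤ, omega M (-(k * (2 * j))) * omega M (-(k * -j)) ^ 2 = 1 ∧
      omega M (-(k * (-2 * j))) * omega M (-(k * j)) ^ 2 = 1 ∧
      omega M (-(k * -j)) * omega M (-(k * j)) = 1 := fun k => by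
    refine ⟨?_, ?_, ?_⟩ <;> simp only [pow_two, ← omega_add] <;> ring_nf <;> exact omega_zero M
  have hGp : Per Λ G := fun l hl z => by
    obtain ⟨k, hk⟩ := exists_P_add_eq h hΛ hl
    obtain ⟨h1, h2, -⟩ := hchar k
    simp only [hG, hk]
    linear_combination (P L M α (2 * j) z * P L M α (-j) z ^ 2) * h1 -
      (P L M α (-2 * j) z * P L M α j z ^ 2) * h2
  have hKp : Per Λ K := fun l hl z => by
    obtain ⟨k, hk⟩ := exists_P_add_eq h hΛ hl
    obtain ⟨-, -, h3⟩ := hchar k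
    simp only [hK, hk]
    linear_combination (P L M α (-j) z * P L M α j z) * h3
  -- The leading coefficient of `P_i` at `0` is even in `i`, so the two terms of order `-3` cancel.
  obtain ⟨c, hc⟩ : ∃ c, LeadAt G 0 (-2) c := by
    have h1 := ((leadAt_P_zero h (2 * j)).mul ((leadAt_P_zero h (-j)).pow 2)).sub
      ((leadAt_P_zero h (-2 * j)).mul ((leadAt_P_zero h j).pow 2))
    have e1 : -(2 * j) = -2 * j := by ring
    have e2 : -(-2 * j) = 2 * j := by ring
    rw [e1, e2, neg_neg] at h1
    have h2 : LeadAt G 0 (-3) 0 := by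
      convert h1 using 1
      · norm_num
      · ring
    simpa using h2.succ
  have hKl := (leadAt_P_zero h (-j)).mul (leadAt_P_zero h j)
  norm_num at hKl
  have hd : (omega M j + omega M (-j) - 2) * (omega M (-j) + omega M j - 2) ≠ 0 :=
    mul_ne_zero (by simpa using hrj') hrj
  set d := (omega M j + omega M (-j) - 2) * (omega M (-j) + omega M j - 2) with hdef
  -- `K` has an exact double pole, so a multiple of it, namely `λ = c / d`, removes that of `G`.
  have hlead := hc.sub (hKl.const_mul (c / d))
  rw [div_mul_cancel₀ c hd, sub_self] at hlead
  obtain ⟨e, he⟩ := hlead.succ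
  obtain ⟨mu, hmu⟩ := Per.eq_const (L := Λ) (f := fun z => G z - c / d * K z)
    (fun l hl z => by simp only [hGp l hl, hKp l hl])
    (fun a ha => (((han _ ha).mul ((han _ ha).pow 2)).sub ((han _ ha).mul ((han _ ha).pow 2))).sub
      (analyticAt_const.mul ((han _ ha).mul (han _ ha)))) he
  refine ⟨c / d, mu, ?_, fun z hz => by
    have := hmu z hz
    simp only [hG, hK] at this
    linear_combination this⟩
  rintro rfl
  -- Suppose `μ = 0`. Then `R` is `Λ`-elliptic and has its only pole at `0`, a simple one, which is
  -- impossible.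
  set R : ℂ → ℂ := fun z => P L M α (2 * j) z * P L M α (-j) z / P L M α j z with hR
  have hRp : Per Λ R := fun l hl z => by
    obtain ⟨k, hk⟩ := exists_P_add_eq h hΛ hl
    have h1 : omega M (-(k * (2 * j))) * omega M (-(k * -j)) = omega M (-(k * j)) := by
      rw [← omega_add]
      congr 1
      ring
    simp only [hR, hk]
    rw [mul_mul_mul_comm, h1, mul_div_mul_left _ _ (omega_ne_zero _ _)]
  have hRl : ∀ a ∉ Λ.lattice, ∃ b, LeadAt R a 0 b := fun a ha => by
    by_cases h0 : P L M α j a = 0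
    · have h1 := P_neg_ne_zero h hΛ hj ha h0
      -- Where `P_j` vanishes, dividing the relation with `μ = 0` by `P_j P_{-j}` rewrites `R` with
      -- denominator `P_{-j}`, which is nonzero there.
      have hS : AnalyticAt ℂ (fun z => c / d + P L M α (-2 * j) z * P L M α j z / P L M α (-j) z) a :=
        analyticAt_const.add (((han _ ha).mul (han _ ha)).div (han _ ha) h1)
      have hne : ∀ᶠ z in 𝓝[≠] a, P L M α j z ≠ 0 := by
        rcases (han j ha).eventually_eq_zero_or_eventually_ne_zero with h2 | h2
        · exact absurd (leadAt_eq_zero_of_eventually (meromorphicAt_P h hΛ j)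
            (h2.filter_mono nhdsWithin_le_nhds) (leadAt_P_zero h j)) hrj
        · exact h2
      refine ⟨_, hS.leadAt.congr ?_⟩
      filter_upwards [hne, ((han (-j) ha).continuousAt.eventually_ne h1).filter_mono
        nhdsWithin_le_nhds, eventually_notMem_lattice Λ a] with z h2 h3 h4
      have h5 := hmu z h4
      simp only [hG, hK] at h5
      simp only [hR]
      field_simp at h5 ⊢
      linear_combination h5
    · exact ⟨_, (((han _ ha).mul (han _ ha)).div (han _ ha) h0).leadAt⟩
  have hR0 := ((leadAt_P_zero h (2 * j)).mul (leadAt_P_zero h (-j))).div (leadAt_P_zero h j) hrj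
  have h1 := Per.residue_eq_zero hRp.reg (fun a ha => by
    obtain ⟨b, hb⟩ := hRl a ha
    exact hb.analyticAt_reg) (by simpa using hR0.reg)
  exact div_ne_zero (mul_ne_zero hr2 (by simpa using hrj')) hrj h1

end P

/-! ### Lattices -/

/-- A lattice, enlarged by a point of finite order, is again a lattice. -/
theorem exists_isExtension (L : PeriodPair) {α : ℂ} {N : ℕ} (hN : N ≠ 0)
    (hα : (N : ℂ) * α ∈ L.lattice) : ∃ Λ, IsExtension L α Λ := by
  set S : Submodule ℤ ℂ := L.lattice ⊔ Submodule.span ℤ {α} with hS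
  have hmem : ∀ z, z ∈ S ↔ ∃ k : ℤ, z - k * α ∈ L.lattice := fun z => by
    rw [hS, Submodule.mem_sup]
    constructor
    · rintro ⟨y, hy, w, hw, rfl⟩
      obtain ⟨k, rfl⟩ := Submodule.mem_span_singleton.1 hw
      exact ⟨k, by simpa using hy⟩
    · rintro ⟨k, hk⟩
      exact ⟨_, hk, k * α, Submodule.mem_span_singleton.2 ⟨k, by simp⟩, by ring⟩
  have hmul : ∀ z : S, (N : ℂ) * z ∈ L.lattice := fun z => by
    obtain ⟨k, hk⟩ := (hmem z).1 z.2
    have h1 := add_mem (L.lattice.smul_mem (N : ℤ) hk) (L.lattice.smul_mem k hα)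
    convert h1 using 1
    simp only [zsmul_eq_mul]
    push_cast
    ring
  -- Multiplication by `N` maps `S` continuously and injectively into the discrete lattice of `L`.
  have hd : DiscreteTopology S := by
    refine DiscreteTopology.of_continuous_injective
      (f := fun z : S => (⟨N * z, hmul z⟩ : L.lattice)) (by fun_prop) fun z w h => ?_
    have h1 : (N : ℂ) * z = N * w := congrArg Subtype.val h
    exact Subtype.ext (mul_left_cancel₀ (Nat.cast_ne_zero.2 hN) h1)
  have hz : IsZLattice ℝ S := ⟨by
    rw [eq_top_iff, ← IsZLattice.span_top (K := ℝ) (L := L.lattice)]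
    exact Submodule.span_mono (le_sup_left : L.lattice ≤ S)⟩
  have hfree : Module.Free ℤ S := ZLattice.module_free ℝ S
  have hfin : Module.Finite ℤ S := ZLattice.module_finite ℝ S
  have hr : Module.finrank ℤ S = 2 := by
    rw [ZLattice.rank ℝ S, Complex.finrank_real_complex]
  set b : Module.Basis (Fin 2) ℤ S := Module.finBasisOfFinrankEq ℤ S hr
  set B := b.ofZLatticeBasis ℝ S
  have hB : ![B 0, B 1] = B := by
    ext i
    fin_cases i <;> rfl
  refine ⟨⟨B 0, B 1, by rw [hB]; exact B.linearIndependent⟩, fun z => ?_⟩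
  rw [← hmem z]
  have h1 : PeriodPair.lattice ⟨B 0, B 1, by rw [hB]; exact B.linearIndependent⟩ = S := by
    rw [← b.ofZLatticeBasis_span ℝ S, PeriodPair.lattice]
    congr 1
    ext x
    simp [Fin.exists_fin_two, eq_comm, B]
  rw [h1]

theorem int_coord_unique (L : PeriodPair) {a b c d : ℤ}
    (h : a * L.ω₁ + b * L.ω₂ = c * L.ω₁ + d * L.ω₂) : a = c ∧ b = d := by
  have h1 := LinearIndependent.pair_iff.1 L.indep (a - c) (b - d) (by
    simp only [Complex.real_smul]
    push_cast
    linear_combination h)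
  exact ⟨by exact_mod_cast sub_eq_zero.1 h1.1, by exact_mod_cast sub_eq_zero.1 h1.2⟩

/-! ### The double cover for even `N`. -/

section Cover

variable {L L' Λ : PeriodPair} {N : ℕ} {α : ℂ}

/-- `Nα` represents the nontrivial class of `L` modulo `L'`, so `eNα` lies in `L'` exactly for even
`e`. -/
theorem hasTorsion_of_index_two (hN : 2 ≤ N) (hα : ∀ k : ℤ, k * α ∈ L.lattice ↔ (N : ℤ) ∣ k)
    (hle : ∀ z ∈ L'.lattice, z ∈ L.lattice) (hn : N * α ∉ L'.lattice)
    (hx : ∀ z ∈ L.lattice, z ∈ L'.lattice ∨ z - N * α ∈ L'.lattice) :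
    HasTorsion L' (2 * N) α := by
  have hNα : (N : ℂ) * α ∈ L.lattice := by
    have := (hα N).2 dvd_rfl
    exact_mod_cast this
  have h2 : 2 * (N * α) ∈ L'.lattice := by
    refine (hx _ (by rw [two_mul]; exact add_mem hNα hNα)).resolve_right fun h => hn ?_
    convert h using 1
    ring
  have hev : ∀ f : ℤ, f * (2 * (N * α)) ∈ L'.lattice := fun f => by
    simpa using L'.lattice.smul_mem f h2
  refine ⟨by omega, fun k => ⟨fun h => ?_, ?_⟩⟩
  · obtain ⟨e, rfl⟩ := (hα k).1 (hle _ h)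
    rcases Int.even_or_odd' e with ⟨f, rfl | rfl⟩
    · exact ⟨f, by push_cast; ring⟩
    · refine absurd (sub_mem h (hev f)) ?_
      convert hn using 2
      push_cast
      ring
  · rintro ⟨f, rfl⟩
    convert hev f using 1
    push_cast
    ring

theorem isExtension_of_index_two (hΛ : IsExtension L α Λ)
    (hle : ∀ z ∈ L'.lattice, z ∈ L.lattice)
    (hx : ∀ z ∈ L.lattice, z ∈ L'.lattice ∨ z - N * α ∈ L'.lattice) : IsExtension L' α Λ := by
  intro z
  rw [hΛ z]
  constructor
  · rintro ⟨k, hk⟩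
    rcases hx _ hk with h | h
    · exact ⟨k, h⟩
    · refine ⟨k + N, ?_⟩
      convert h using 1
      push_cast
      ring
  · rintro ⟨k, hk⟩
    exact ⟨k, hle _ hk⟩

theorem doubleFst_le {z : ℂ} (hz : z ∈ (doubleFst L).lattice) : z ∈ L.lattice := by
  obtain ⟨m, n, rfl⟩ := PeriodPair.mem_lattice.1 hz
  refine PeriodPair.mem_lattice.2 ⟨m * 2, n, ?_⟩
  simp only [doubleFst]
  push_cast
  ring

theorem doubleSnd_le {z : ℂ} (hz : z ∈ (doubleSnd L).lattice) : z ∈ L.lattice := by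
  obtain ⟨m, n, rfl⟩ := PeriodPair.mem_lattice.1 hz
  refine PeriodPair.mem_lattice.2 ⟨m, n * 2, ?_⟩
  simp only [doubleSnd]
  push_cast
  ring

theorem mem_doubleFst_iff {a b : ℤ} :
    a * L.ω₁ + b * L.ω₂ ∈ (doubleFst L).lattice ↔ Even a := by
  rw [PeriodPair.mem_lattice]
  constructor
  · rintro ⟨m, n, h⟩
    have h1 : ((m * 2 : ℤ) : ℂ) * L.ω₁ + n * L.ω₂ = a * L.ω₁ + b * L.ω₂ := by
      rw [← h]
      simp only [doubleFst]
      push_cast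
      ring
    rw [← (int_coord_unique L h1).1]
    exact even_two.mul_left m
  · rintro ⟨m, rfl⟩
    refine ⟨m, b, ?_⟩
    simp only [doubleFst]
    push_cast
    ring

theorem mem_doubleSnd_iff {a b : ℤ} :
    a * L.ω₁ + b * L.ω₂ ∈ (doubleSnd L).lattice ↔ Even b := by
  rw [PeriodPair.mem_lattice]
  constructor
  · rintro ⟨m, n, h⟩
    have h1 : (m : ℂ) * L.ω₁ + ((n * 2 : ℤ) : ℂ) * L.ω₂ = a * L.ω₁ + b * L.ω₂ := by
      rw [← h]
      simp only [doubleSnd]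
      push_cast
      ring
    rw [← (int_coord_unique L h1).2]
    exact even_two.mul_left n
  · rintro ⟨m, rfl⟩
    refine ⟨a, m, ?_⟩
    simp only [doubleSnd]
    push_cast
    ring

/-- The last clause recovers what the cover loses: a period of `L` that is not a period of the cover
is one up to `Nα`, and translation by `Nα` changes `Φ` only by a central sign. -/
theorem hasTorsion_cover (hN : 2 ≤ N) (hα : ∀ k : ℤ, k * α ∈ L.lattice ↔ (N : ℤ) ∣ k)
    (hΛ : IsExtension L α Λ) :
    HasTorsion (cover L N α) (coverOrder N) α ∧ IsExtension (cover L N α) α Λ ∧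
      (∀ z ∈ L.lattice, z ∈ (cover L N α).lattice ∨
        (Even N ∧ z - N * α ∈ (cover L N α).lattice)) := by
  rw [cover, coverOrder]
  by_cases hodd : Odd N
  · rw [if_pos hodd, if_pos hodd]
    refine ⟨⟨?_, hα⟩, hΛ, fun z hz => Or.inl hz⟩
    rcases hodd with ⟨k, rfl⟩
    omega
  rw [if_neg hodd, if_neg hodd]
  have heven : Even N := Nat.not_odd_iff_even.1 hodd
  have hNα : (N : ℂ) * α ∈ L.lattice := by
    have := (hα N).2 dvd_rfl
    exact_mod_cast this
  split_ifs with hab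
  · obtain ⟨a, b, ha, hab⟩ := hab
    have hx : ∀ z ∈ L.lattice, z ∈ (doubleFst L).lattice ∨
        z - N * α ∈ (doubleFst L).lattice := fun z hz => by
      obtain ⟨m, n, rfl⟩ := PeriodPair.mem_lattice.1 hz
      rcases Int.even_or_odd m with hm | hm
      · exact Or.inl (mem_doubleFst_iff.2 hm)
      · right
        have := (mem_doubleFst_iff (L := L) (a := m - a) (b := n - b)).2 (hm.sub_odd ha)
        convert this using 1
        rw [hab]
        push_cast
        ring
    refine ⟨hasTorsion_of_index_two hN hα (fun z => doubleFst_le) ?_ hx,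
      isExtension_of_index_two hΛ (fun z => doubleFst_le) hx,
      fun z hz => (hx z hz).imp id fun h => ⟨heven, h⟩⟩
    rw [hab, mem_doubleFst_iff]
    exact Int.not_even_iff_odd.2 ha
  · obtain ⟨a, b, hmn⟩ := PeriodPair.mem_lattice.1 hNα
    have ha : Even a := Int.not_odd_iff_even.1 fun h => hab ⟨a, b, h, hmn.symm⟩
    -- If both coordinates of `Nα` were even, then `(N / 2) α` would be a period, against the order
    -- `N` of `α`.
    have hb : Odd b := by
      rw [← Int.not_even_iff_odd]
      rintro ⟨d, rfl⟩
      obtain ⟨c, rfl⟩ := ha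
      obtain ⟨n, rfl⟩ := heven
      have h1 : (n : ℤ) * α ∈ L.lattice := PeriodPair.mem_lattice.2 ⟨c, d, by
        push_cast at hmn ⊢
        linear_combination hmn / 2⟩
      have h2 := Int.le_of_dvd (by omega) ((hα n).1 (by exact_mod_cast h1))
      push_cast at h2
      omega
    have hx : ∀ z ∈ L.lattice, z ∈ (doubleSnd L).lattice ∨
        z - N * α ∈ (doubleSnd L).lattice := fun z hz => by
      obtain ⟨m, n, rfl⟩ := PeriodPair.mem_lattice.1 hz
      rcases Int.even_or_odd n with hm | hm
      · exact Or.inl (mem_doubleSnd_iff.2 hm)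
      · right
        have := (mem_doubleSnd_iff (L := L) (a := m - a) (b := n - b)).2 (hm.sub_odd hb)
        convert this using 1
        rw [← hmn]
        push_cast
        ring
    refine ⟨hasTorsion_of_index_two hN hα (fun z => doubleSnd_le) ?_ hx,
      isExtension_of_index_two hΛ (fun z => doubleSnd_le) hx,
      fun z hz => (hx z hz).imp id fun h => ⟨heven, h⟩⟩
    rw [← hmn, mem_doubleSnd_iff]
    exact Int.not_even_iff_odd.2 hb

end Cover

/-! ### Translations of the torus -/

section Torus

variable {L Λ : PeriodPair} {Γ : Type*} [Group Γ] {σ : Γ →* translations L}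

theorem proj_add (z w : ℂ) : proj L (z + w) = proj L z + proj L w := rfl

theorem proj_eq_iff {z w : ℂ} : proj L z = proj L w ↔ z - w ∈ L.lattice :=
  Submodule.Quotient.eq _

theorem exists_proj_eq (p : Torus L) : ∃ z, proj L z = p := Submodule.Quotient.mk_surjective _ p

theorem translation_apply (σ : Γ →* translations L) (γ : Γ) (p : Torus L) :
    (σ γ).1 p = p + (σ γ).1 0 := by
  obtain ⟨a, ha⟩ := (σ γ).2
  rw [ha, ha, zero_add]

theorem translation_mul (σ : Γ →* translations L) (γ δ : Γ) :
    (σ (γ * δ)).1 0 = (σ γ).1 0 + (σ δ).1 0 := by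
  rw [map_mul, Subgroup.coe_mul, Equiv.Perm.mul_apply, translation_apply, add_comm]

theorem translation_one (σ : Γ →* translations L) : (σ 1).1 0 = 0 := by
  rw [map_one]
  rfl

theorem translation_zpow (σ : Γ →* translations L) {r : Γ} {α : ℂ} (hα : (σ r).1 0 = proj L α)
    (k : ℤ) : (σ (r ^ k)).1 0 = proj L (k * α) := by
  induction k using Int.induction_on with
  | zero => simp [proj]
  | succ k ih =>
    rw [zpow_add_one, translation_mul, ih, hα, ← proj_add]
    congr 1
    push_cast
    ring
  | pred k ih =>
    have h1 : r ^ (-k : ℤ) = r ^ (-k - 1 : ℤ) * r := by rw [← zpow_add_one]; congr 1; ring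
    rw [h1, translation_mul, hα] at ih
    rw [eq_sub_of_add_eq ih]
    refine (proj_eq_iff.2 ?_ : proj L (_ - α) = _)
    convert zero_mem L.lattice using 1
    push_cast
    ring

theorem eq_one_of_translation (hσ : Function.Injective σ) {γ : Γ} (h : (σ γ).1 0 = 0) :
    γ = 1 := by
  refine hσ (Subtype.ext (Equiv.ext fun p => ?_))
  rw [translation_apply σ γ, translation_apply σ 1, h, translation_one]

theorem mul_mem_lattice_iff [Finite Γ] (hσ : Function.Injective σ) {r : Γ}
    (hr : ∀ γ : Γ, γ ∈ Subgroup.zpowers r) {α : ℂ} (hα : (σ r).1 0 = proj L α) (k : ℤ) :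
    k * α ∈ L.lattice ↔ (Nat.card Γ : ℤ) ∣ k := by
  rw [← orderOf_eq_card_of_forall_mem_zpowers hr, orderOf_dvd_iff_zpow_eq_one]
  have h1 : k * α ∈ L.lattice ↔ (σ (r ^ k)).1 0 = 0 := by
    rw [translation_zpow σ hα]
    exact (Submodule.Quotient.mk_eq_zero _).symm
  rw [h1]
  exact ⟨eq_one_of_translation hσ, fun h => by rw [h, translation_one]⟩

theorem mem_orbitZero_iff {r : Γ} (hr : ∀ γ : Γ, γ ∈ Subgroup.zpowers r) {α : ℂ}
    (hα : (σ r).1 0 = proj L α) (z : ℂ) :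
    proj L z ∈ orbitZero σ ↔ ∃ k : ℤ, z - k * α ∈ L.lattice := by
  constructor
  · rintro ⟨γ, hγ⟩
    obtain ⟨k, rfl⟩ := Subgroup.mem_zpowers_iff.1 (hr γ)
    rw [translation_zpow σ hα] at hγ
    exact ⟨k, proj_eq_iff.1 hγ.symm⟩
  · rintro ⟨k, hk⟩
    exact ⟨r ^ k, by rw [translation_zpow σ hα]; exact (proj_eq_iff.2 hk).symm⟩

end Torus

open Matrix

/-! ### Automorphisms of `sl₂` -/

theorem autSL2_mul_apply (a b : AutSL2) (x : SL2) : (a * b) x = a (b x) := rfl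

theorem autSL2_one_apply (x : SL2) : (1 : AutSL2) x = x := rfl

theorem SL2.trace_eq_zero (x : SL2) : x.1 0 0 + x.1 1 1 = 0 := by
  have hx : Matrix.trace x.1 = 0 := by simpa [LieAlgebra.SpecialLinear.sl] using x.2
  rwa [Matrix.trace_fin_two] at hx

theorem SL2.eq_std (x : SL2) : x = x.1 0 1 • stdE + x.1 1 0 • stdF + x.1 0 0 • stdH := by
  have h := x.trace_eq_zero
  ext i j
  fin_cases i <;> fin_cases j <;> simp [stdE, stdF, stdH]
  linear_combination h

theorem SL2.lie_val (x y : SL2) : (⁅x, y⁆ : SL2).1 = x.1 * y.1 - y.1 * x.1 := rfl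

theorem lie_stdE_stdF : ⁅stdE, stdF⁆ = stdH := by
  ext i j
  rw [SL2.lie_val]
  fin_cases i <;> fin_cases j <;> simp [stdE, stdF, stdH]

theorem lie_stdH_stdE : ⁅stdH, stdE⁆ = (2 : ℂ) • stdE := by
  ext i j
  rw [SL2.lie_val]
  fin_cases i <;> fin_cases j <;> simp [stdE, stdH]
  norm_num

theorem lie_stdH_stdF : ⁅stdH, stdF⁆ = (-2 : ℂ) • stdF := by
  ext i j
  rw [SL2.lie_val]
  fin_cases i <;> fin_cases j <;> simp [stdF, stdH]
  norm_num

section Ad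

variable {g k : Matrix (Fin 2) (Fin 2) ℂ}

theorem Ad_val (g : Matrix (Fin 2) (Fin 2) ℂ) (x : SL2) : (Ad g x).1 = g * x.1 * g⁻¹ := rfl

theorem Ad_eq_iff (hg : IsUnit g.det) {x y : SL2} : Ad g x = y ↔ g * x.1 = y.1 * g := by
  rw [Subtype.ext_iff, Ad_val]
  constructor
  · intro h
    rw [← h, Matrix.nonsing_inv_mul_cancel_right _ _ hg]
  · intro h
    rw [h, Matrix.mul_nonsing_inv_cancel_right _ _ hg]

theorem Ad_mul (g k : Matrix (Fin 2) (Fin 2) ℂ) (x : SL2) : Ad (g * k) x = Ad g (Ad k x) :=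
  Subtype.ext (by simp only [Ad_val, Matrix.mul_inv_rev, Matrix.mul_assoc])

theorem Ad_one (x : SL2) : Ad 1 x = x := Subtype.ext (by simp [Ad_val])

theorem Ad_smul {c : ℂ} (hc : c ≠ 0) (hg : IsUnit g.det) (x : SL2) : Ad (c • g) x = Ad g x := by
  have h1 : IsUnit (c • g).det := by
    rw [Matrix.det_smul]
    exact (IsUnit.mk0 _ (pow_ne_zero _ hc)).mul hg
  rw [Ad_eq_iff h1, Matrix.smul_mul, (Ad_eq_iff hg).1 rfl, Matrix.mul_smul]

theorem Ad_add (g : Matrix (Fin 2) (Fin 2) ℂ) (x y : SL2) : Ad g (x + y) = Ad g x + Ad g y :=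
  Subtype.ext (by
    rw [Submodule.coe_add, Ad_val, Ad_val, Ad_val, ← add_mul, ← mul_add]
    rfl)

theorem Ad_smul_right (g : Matrix (Fin 2) (Fin 2) ℂ) (c : ℂ) (x : SL2) :
    Ad g (c • x) = c • Ad g x :=
  Subtype.ext (by
    change g * (c • x.1) * g⁻¹ = c • (g * x.1 * g⁻¹)
    rw [Matrix.mul_smul, Matrix.smul_mul])

theorem Ad_lie (hg : IsUnit g.det) (x y : SL2) : Ad g ⁅x, y⁆ = ⁅Ad g x, Ad g y⁆ := by
  rw [Ad_eq_iff hg, SL2.lie_val, SL2.lie_val]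
  have h1 := (Ad_eq_iff hg).1 (rfl : Ad g x = Ad g x)
  have h2 := (Ad_eq_iff hg).1 (rfl : Ad g y = Ad g y)
  rw [mul_sub, sub_mul, ← mul_assoc, h1, mul_assoc, h2, ← mul_assoc g, h2, mul_assoc _ g, h1]
  simp only [mul_assoc]

/-- Conjugation by an invertible matrix, as an automorphism of `sl₂`. -/
def adAut (g : Matrix (Fin 2) (Fin 2) ℂ) (hg : IsUnit g.det) : AutSL2 where
  toFun := Ad g
  map_add' := Ad_add g
  map_smul' := Ad_smul_right g
  map_lie' := Ad_lie hg _ _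
  invFun := Ad g⁻¹
  left_inv x := by
    rw [← Ad_mul, Matrix.nonsing_inv_mul _ hg, Ad_one]
  right_inv x := by
    rw [← Ad_mul, Matrix.mul_nonsing_inv _ hg, Ad_one]

theorem adAut_apply (hg : IsUnit g.det) (x : SL2) : adAut g hg x = Ad g x := rfl

end Ad

theorem sq_eq_smul_of_trace {X : Matrix (Fin 2) (Fin 2) ℂ} (h : X 0 0 + X 1 1 = 0) :
    X * X = (-X.det) • (1 : Matrix (Fin 2) (Fin 2) ℂ) := by
  have h1 : X 1 1 = - X 0 0 := by linear_combination h
  ext i j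
  fin_cases i <;> fin_cases j <;> simp [Matrix.mul_apply, Matrix.det_fin_two, h1] <;> ring

/-- An `sl₂`-triple in `2 × 2` matrices consists of matrix units. -/
theorem triple_relations {E F H : SL2} (hHE : ⁅H, E⁆ = (2 : ℂ) • E)
    (hHF : ⁅H, F⁆ = (-2 : ℂ) • F) (hEF : ⁅E, F⁆ = H) :
    E.1 * E.1 = 0 ∧ F.1 * F.1 = 0 ∧ E.1 * F.1 * E.1 = E.1 ∧ F.1 * E.1 * F.1 = F.1 := by
  -- `X²` is an eigenvector of `ad H` for `2c`, or zero; since `X` is traceless, `X²` is scalar and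
  -- commutes with `H`, so it is zero.
  have sq : ∀ (X : SL2) (c : ℂ), c ≠ 0 → ⁅H, X⁆ = c • X → X.1 * X.1 = 0 := fun X c hc hX => by
    have h1 : H.1 * X.1 - X.1 * H.1 = c • X.1 := congrArg Subtype.val hX
    have h2 := sq_eq_smul_of_trace X.trace_eq_zero
    have h3 : H.1 * (X.1 * X.1) - X.1 * X.1 * H.1 = (2 * c) • (X.1 * X.1) := by
      have h4 : H.1 * (X.1 * X.1) - X.1 * X.1 * H.1 =
          (H.1 * X.1 - X.1 * H.1) * X.1 + X.1 * (H.1 * X.1 - X.1 * H.1) := by noncomm_ring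
      rw [h4, h1, Matrix.smul_mul, Matrix.mul_smul, two_mul, add_smul]
    have h5 : H.1 * (X.1 * X.1) - X.1 * X.1 * H.1 = 0 := by rw [h2]; simp
    rw [h5] at h3
    exact (smul_eq_zero.1 h3.symm).resolve_left (mul_ne_zero two_ne_zero hc)
  have hE2 := sq E 2 two_ne_zero hHE
  have hF2 := sq F (-2) (by norm_num) hHF
  have e1 : H.1 * E.1 - E.1 * H.1 = (2 : ℂ) • E.1 := congrArg Subtype.val hHE
  have e2 : H.1 * F.1 - F.1 * H.1 = (-2 : ℂ) • F.1 := congrArg Subtype.val hHF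
  have e3 : E.1 * F.1 - F.1 * E.1 = H.1 := congrArg Subtype.val hEF
  refine ⟨hE2, hF2, ?_, ?_⟩
  -- With `H = EF - FE` and `E² = 0`, the bracket `[H, E]` equals `2 EFE`; comparison with `2E`
  -- gives the claim.
  · have h1 : H.1 * E.1 - E.1 * H.1 = (2 : ℂ) • (E.1 * F.1 * E.1) := by
      have : H.1 * E.1 - E.1 * H.1 =
          (2 : ℂ) • (E.1 * F.1 * E.1) - F.1 * (E.1 * E.1) - (E.1 * E.1) * F.1 := by
        rw [← e3, two_smul]
        noncomm_ring
      rw [this, hE2]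
      simp
    rw [e1] at h1
    exact (smul_right_injective _ (two_ne_zero (α := ℂ)) h1).symm
  · have h1 : H.1 * F.1 - F.1 * H.1 = (-2 : ℂ) • (F.1 * E.1 * F.1) := by
      have : H.1 * F.1 - F.1 * H.1 =
          (-2 : ℂ) • (F.1 * E.1 * F.1) + E.1 * (F.1 * F.1) + (F.1 * F.1) * E.1 := by
        rw [← e3, neg_smul, two_smul]
        noncomm_ring
      rw [this, hF2]
      simp
    rw [e2] at h1
    exact (smul_right_injective _ (by norm_num : (-2 : ℂ) ≠ 0) h1).symm

/-- Every automorphism of `sl₂` is inner. -/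
theorem exists_eq_Ad (φ : AutSL2) :
    ∃ g : Matrix (Fin 2) (Fin 2) ℂ, IsUnit g.det ∧ ∀ x, φ x = Ad g x := by
  have hE0 : (φ stdE).1 ≠ 0 := fun h => by
    have h1 := φ.toLinearEquiv.map_eq_zero_iff.1 (Subtype.ext h : φ.toLinearEquiv stdE = 0)
    have := congrFun (congrFun (congrArg Subtype.val h1) 0) 1
    simp [stdE] at this
  obtain ⟨hEE, hFF, hEFE, hFEF⟩ := triple_relations (E := φ stdE) (F := φ stdF) (H := φ stdH)
    (by rw [← LieEquiv.map_lie, lie_stdH_stdE, map_smul])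
    (by rw [← LieEquiv.map_lie, lie_stdH_stdF, map_smul])
    (by rw [← LieEquiv.map_lie, lie_stdE_stdF])
  obtain ⟨hee, hff, hefe, hfef⟩ := triple_relations (E := stdE) (F := stdF) (H := stdH)
    lie_stdH_stdE lie_stdH_stdF lie_stdE_stdF
  set E := (φ stdE).1
  set F := (φ stdF).1
  have hEF : E * F ≠ 0 := fun h => hE0 (by rw [← hEFE, h, zero_mul])
  obtain ⟨i, l, hil⟩ : ∃ i l, (E * F) i l ≠ 0 := by
    by_contra! h
    exact hEF (by ext i l; exact h i l)
  set A : Matrix (Fin 2) (Fin 2) ℂ := Matrix.single l 0 1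
  set B : Matrix (Fin 2) (Fin 2) ℂ := Matrix.single 0 i 1
  set e := stdE.1
  set f := stdF.1
  have hY : (B * (E * F) * A) 0 0 = (E * F) i l := by simp [A, B]
  -- For every `A` this matrix intertwines `e, f` with `E, F`. Taking for `A` the matrix unit
  -- attached to a nonzero entry of `EF` makes it invertible: `hkg` gives a left inverse up to that
  -- entry.
  set g := E * F * A * (e * f) + F * A * e with hg
  have hkg : (e * f * B * (E * F) + f * B * E) * g = (E * F) i l • 1 := by
    have h1 : (e * f * B * (E * F) + f * B * E) * g =
        e * f * (B * (E * F * E * F) * A) * (e * f) + f * (B * (E * F) * A) * e +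
        e * f * B * (E * (F * F)) * A * e + f * B * ((E * E) * F) * A * (e * f) := by
      rw [hg]
      noncomm_ring
    rw [h1, hEFE, hFF, hEE, ← hY]
    generalize B * (E * F) * A = Y
    have he : e = !![0, 1; 0, 0] := rfl
    have hf : f = !![0, 0; 1, 0] := rfl
    rw [he, hf, Matrix.eta_fin_two Y, Matrix.one_fin_two]
    simp
  have hdet : IsUnit g.det := by
    rw [isUnit_iff_ne_zero]
    intro h0
    have := congrArg Matrix.det hkg
    rw [Matrix.det_mul, h0, mul_zero, Matrix.det_smul, Matrix.det_one, mul_one] at this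
    exact pow_ne_zero _ hil this.symm
  have h1 : Ad g stdE = φ stdE := by
    rw [Ad_eq_iff hdet]
    change g * e = E * g
    calc g * e = E * F * A * (e * f * e) + F * A * (e * e) := by rw [hg]; noncomm_ring
      _ = E * F * A * e + E * E * F * A * (e * f) := by rw [hefe, hee, hEE]; simp
      _ = E * g := by rw [hg]; noncomm_ring
  have h2 : Ad g stdF = φ stdF := by
    rw [Ad_eq_iff hdet]
    change g * f = F * g
    calc g * f = E * F * A * (e * (f * f)) + F * A * (e * f) := by rw [hg]; noncomm_ring
      _ = F * E * F * A * (e * f) + F * F * A * e := by rw [hff, hFEF, hFF]; simp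
      _ = F * g := by rw [hg]; noncomm_ring
  refine ⟨g, hdet, fun x => ?_⟩
  have h3 : φ stdH = Ad g stdH := by
    rw [← lie_stdE_stdF, LieEquiv.map_lie, Ad_lie hdet, h1, h2]
  rw [x.eq_std]
  simp only [map_add, map_smul, Ad_add, Ad_smul_right, h1, h2, h3]

theorem smul_one_of_commute {A : Matrix (Fin 2) (Fin 2) ℂ} (h : ∀ x : SL2, A * x.1 = x.1 * A) :
    A 0 1 = 0 ∧ A 1 0 = 0 ∧ A 0 0 = A 1 1 := by
  have h1 := h stdE
  have h2 := h stdF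
  have e1 := congrFun (congrFun h1 0) 0
  have e2 := congrFun (congrFun h1 0) 1
  have e3 := congrFun (congrFun h2 0) 0
  simp [stdE, stdF, Matrix.mul_apply] at e1 e2 e3
  exact ⟨e3, e1.symm, e2⟩

/-- A square root `s` of the discriminant of the characteristic polynomial decides: distinct
eigenvalues if `s ≠ 0`, and otherwise a double eigenvalue `a` with `(g - a)² = 0` by
Cayley–Hamilton. -/
theorem exists_diagonal_or_nilpotent (g : Matrix (Fin 2) (Fin 2) ℂ) :
    (∃ (Q : Matrix (Fin 2) (Fin 2) ℂ) (a b : ℂ), IsUnit Q.det ∧ g * Q = Q * !![a, 0; 0, b]) ∨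
    ∃ (a : ℂ) (n : Matrix (Fin 2) (Fin 2) ℂ), n * n = 0 ∧ g = a • 1 + n := by
  obtain ⟨s, hs⟩ := IsAlgClosed.exists_pow_nat_eq ((g 0 0 + g 1 1) ^ 2 - 4 * g.det) two_pos
  replace hs := hs.symm
  rw [Matrix.det_fin_two] at hs
  by_cases h0 : s = 0
  · right
    refine ⟨(g 0 0 + g 1 1) / 2, g - ((g 0 0 + g 1 1) / 2) • 1, ?_, by simp⟩
    rw [h0] at hs
    ext i j
    fin_cases i <;> fin_cases j <;> simp [Matrix.mul_apply] <;>
      first | linear_combination hs / 4 | ring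
  · left
    have hv : ∀ a : ℂ, (a - g 0 0) * (a - g 1 1) = g 0 1 * g 1 0 →
        ∃ x y : ℂ, (x ≠ 0 ∨ y ≠ 0) ∧ g 0 0 * x + g 0 1 * y = a * x ∧
          g 1 0 * x + g 1 1 * y = a * y := fun a ha => by
      by_cases h1 : g 0 1 = 0
      · rw [h1, zero_mul] at ha
        by_cases h2 : a = g 1 1
        · exact ⟨0, 1, by simp, by simp [h1], by simp [h2]⟩
        · refine ⟨a - g 1 1, g 1 0, Or.inl (sub_ne_zero.2 h2), ?_, by ring⟩
          rw [h1]
          linear_combination -ha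
      · exact ⟨g 0 1, a - g 0 0, Or.inl h1, by ring, by linear_combination -ha⟩
    obtain ⟨x, y, hxy, e1, e2⟩ := hv ((g 0 0 + g 1 1 + s) / 2) (by linear_combination -hs / 4)
    obtain ⟨z, w, hzw, e3, e4⟩ := hv ((g 0 0 + g 1 1 - s) / 2) (by linear_combination -hs / 4)
    refine ⟨!![x, z; y, w], (g 0 0 + g 1 1 + s) / 2, (g 0 0 + g 1 1 - s) / 2, ?_, ?_⟩
    · rw [Matrix.det_fin_two_of, isUnit_iff_ne_zero]
      -- For dependent eigenvectors, all products of a coordinate of one with a coordinate of the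
      -- other vanish, as `s ≠ 0`; one of the vectors would be zero.
      intro hd
      have k1 : s * (x * z) = 0 := by linear_combination -z * e1 + x * e3 - g 0 1 * hd
      have k2 : s * (y * w) = 0 := by linear_combination -w * e2 + y * e4 + g 1 0 * hd
      have k3 : s * (x * w) = 0 := by
        linear_combination (-w * e1 + x * e4 + y * e3 - z * e2 + (g 0 0 - g 1 1 + s) * hd) / 2
      have k4 : s * (z * y) = 0 := by linear_combination k3 - s * hd
      simp only [mul_eq_zero, h0, false_or] at k1 k2 k3 k4
      tauto
    · ext i j
      fin_cases i <;> fin_cases j <;> simp [Matrix.mul_apply] <;>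
        first | linear_combination e1 | linear_combination e2 | linear_combination e3 |
          linear_combination e4

theorem nilpotent_pow {a : ℂ} {n : Matrix (Fin 2) (Fin 2) ℂ} (hn : n * n = 0) (k : ℕ) :
    (a • 1 + n) ^ (k + 1) = a ^ (k + 1) • 1 + ((k + 1 : ℂ) * a ^ k) • n := by
  induction k with
  | zero => simp
  | succ k ih =>
    rw [pow_succ, ih, add_mul, mul_add, mul_add, Matrix.smul_mul, Matrix.smul_mul, Matrix.smul_mul,
      Matrix.smul_mul, hn, smul_zero, add_zero, one_mul, one_mul, Matrix.mul_smul, mul_one,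
      smul_smul, smul_smul, add_assoc, ← add_smul]
    congr 2
    push_cast
    ring

theorem diagonal_pow_fin_two (a b : ℂ) (k : ℕ) :
    (!![a, 0; 0, b] : Matrix (Fin 2) (Fin 2) ℂ) ^ k = !![a ^ k, 0; 0, b ^ k] := by
  induction k with
  | zero => simp [Matrix.one_fin_two]
  | succ k ih => rw [pow_succ, ih]; simp [pow_succ]

/-- The eigenvalue ratio of `δ_j` is `ω_M^{2j}`. Modulo odd `N = 2m + 1` the number `2` has inverse
`m + 1`, so `M = N` suffices; for even `N` square roots of `N`-th roots of unity are needed, hence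
`M = 2N`. -/
theorem exists_omega_two_mul_eq {N : ℕ} (hN : N ≠ 0) {ζ : ℂ} (hζ : ζ ^ N = 1) :
    ∃ j : ℤ, omega (coverOrder N) (2 * j) = ζ := by
  have : NeZero N := ⟨hN⟩
  have hN' : (N : ℂ) ≠ 0 := Nat.cast_ne_zero.2 hN
  obtain ⟨i, -, hi⟩ := (Complex.isPrimitiveRoot_exp N hN).eq_pow_of_pow_eq_one hζ
  rw [← Complex.exp_nat_mul] at hi
  rw [coverOrder]
  split_ifs with hodd
  · obtain ⟨m, hm⟩ := hodd
    refine ⟨i * (m + 1), ?_⟩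
    have h1 : 2 * ((i : ℤ) * (m + 1)) = i + N * i := by rw [hm]; push_cast; ring
    rw [h1, omega_add, (omega_eq_one_iff hN _).2 (dvd_mul_right _ _), mul_one, ← hi, omega]
    congr 1
    push_cast
    ring
  · refine ⟨i, ?_⟩
    rw [← hi, omega]
    congr 1
    push_cast
    field_simp

theorem isUnit_det_delta (M : ℕ) (j : ℤ) : IsUnit (delta M j).det := by
  rw [delta, Matrix.det_fin_two_of, isUnit_iff_ne_zero]
  simp [omega_ne_zero]

/-- Here `ω^j = ω^{-j}`, so the diagonal matrix is scalar. -/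
theorem Ad_delta_of_dvd {M : ℕ} (hM : M ≠ 0) {j : ℤ} (hj : (M : ℤ) ∣ 2 * j) (x : SL2) :
    Ad (delta M j) x = x := by
  have h1 : delta M j = omega M j • 1 := by
    have h2 : omega M (-j) = omega M j := by
      have h3 : omega M (2 * j) * omega M (-j) = omega M j := by rw [← omega_add]; congr 1; ring
      rwa [(omega_eq_one_iff hM _).2 hj, one_mul] at h3
    rw [delta, h2, Matrix.one_fin_two]
    simp
  rw [h1, Ad_smul (omega_ne_zero _ _) (by simp), Ad_one]

/-- A nontrivial automorphism of `sl₂` of finite order is conjugate to a diagonal one. -/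
theorem exists_conj_delta {φ : AutSL2} {N : ℕ} (hN : N ≠ 0) (hφ : φ ^ N = 1) (hne : φ ≠ 1) :
    ∃ (j : ℤ) (B : AutSL2), ∀ x, φ x = B (Ad (delta (coverOrder N) j) (B.symm x)) := by
  obtain ⟨g, hg, hφg⟩ := exists_eq_Ad φ
  have hpow : ∀ (k : ℕ) (x : SL2), g ^ k * x.1 = ((φ ^ k) x).1 * g ^ k := fun k => by
    induction k with
    | zero => intro x; simp
    | succ k ih =>
      intro x
      rw [pow_succ, pow_succ, mul_assoc, autSL2_mul_apply, ((Ad_eq_iff hg).1 (hφg x).symm),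
        ← mul_assoc, ih, mul_assoc]
  have hcomm : ∀ x : SL2, g ^ N * x.1 = x.1 * g ^ N := fun x => by
    rw [hpow, hφ, autSL2_one_apply]
  rcases exists_diagonal_or_nilpotent g with ⟨Q, a, b, hQ, hgQ⟩ | ⟨a, n, hn, hgn⟩
  · have hab : a ≠ 0 ∧ b ≠ 0 := by
      have h1 := congrArg Matrix.det hgQ
      rw [Matrix.det_mul, Matrix.det_mul, Matrix.det_fin_two_of, mul_comm] at h1
      have h2 := mul_left_cancel₀ hQ.ne_zero h1
      have h3 := hg.ne_zero
      rw [h2] at h3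
      constructor <;> rintro rfl <;> simp at h3
    obtain ⟨h01, h10, h00⟩ := smul_one_of_commute hcomm
    have hgN : g ^ N = (g ^ N) 0 0 • 1 := by
      ext i j
      fin_cases i <;> fin_cases j <;> simp [h01, h10, h00]
    have hQN : ∀ k : ℕ, g ^ k * Q = Q * !![a, 0; 0, b] ^ k := fun k => by
      induction k with
      | zero => simp
      | succ k ih => rw [pow_succ, pow_succ', mul_assoc, hgQ, ← mul_assoc, ih, mul_assoc,
          ← pow_succ, pow_succ']
    have hDN := hQN N
    rw [hgN, Matrix.smul_mul, one_mul, diagonal_pow_fin_two] at hDN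
    have hD : (!![a ^ N, 0; 0, b ^ N] : Matrix (Fin 2) (Fin 2) ℂ) = (g ^ N) 0 0 • 1 := by
      rw [← Matrix.nonsing_inv_mul_cancel_left _ !![a ^ N, 0; 0, b ^ N] hQ, ← hDN,
        Matrix.mul_smul, Matrix.nonsing_inv_mul _ hQ]
    have hD0 := congrFun (congrFun hD 0) 0
    have hD1 := congrFun (congrFun hD 1) 1
    simp at hD0 hD1
    -- `g ^ N` is scalar, so `a ^ N = b ^ N` and the ratio of eigenvalues is an `N`-th root of
    -- unity. Only this ratio matters for `Ad`.
    obtain ⟨j, hj⟩ := exists_omega_two_mul_eq hN (ζ := a / b) (by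
      rw [div_pow, hD0, hD1, div_self]
      rw [← hD1]
      exact pow_ne_zero _ hab.2)
    refine ⟨j, adAut Q hQ, fun x => ?_⟩
    set M := coverOrder N
    have hω : omega M (-j) * omega M j = 1 := by rw [← omega_add, neg_add_cancel, omega_zero]
    have hD2 : (!![a, 0; 0, b] : Matrix (Fin 2) (Fin 2) ℂ) = (a * omega M (-j)) • delta M j := by
      rw [eq_div_iff hab.2] at hj
      have h1 : omega M (2 * j) = omega M j * omega M j := by rw [← omega_add]; congr 1; ring
      rw [h1] at hj
      rw [delta]
      ext i k
      fin_cases i <;> fin_cases k <;> simp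
      · linear_combination -a * hω
      · linear_combination (omega M (-j)) ^ 2 * hj - (omega M (-j) * omega M j + 1) * b * hω
    obtain ⟨y, rfl⟩ : ∃ y, adAut Q hQ y = x := (adAut Q hQ).surjective x
    rw [LieEquiv.symm_apply_apply, adAut_apply, adAut_apply, hφg, ← Ad_mul, hgQ, Ad_mul, hD2,
      Ad_smul (mul_ne_zero hab.1 (omega_ne_zero _ _)) (isUnit_det_delta _ _)]
  -- Since `g ^ N = a ^ N + N a ^ (N - 1) n` commutes with `sl₂` and `a ≠ 0`, so does `n`, hence
  -- `g`, and `φ` would be trivial.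
  · exfalso
    obtain ⟨k, rfl⟩ := Nat.exists_eq_succ_of_ne_zero hN
    have ha : a ≠ 0 := by
      rintro rfl
      rw [zero_smul, zero_add] at hgn
      have := congrArg Matrix.det hn
      rw [← hgn, Matrix.det_mul] at this
      simp [hg.ne_zero] at this
    refine hne (LieEquiv.ext fun x => ?_)
    have h1 := hcomm x
    rw [hgn, Nat.succ_eq_add_one, nilpotent_pow hn, add_mul, mul_add, Matrix.smul_mul,
      Matrix.mul_smul, one_mul, mul_one, add_right_inj, Matrix.smul_mul, Matrix.mul_smul] at h1
    have h2 := smul_right_injective _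
      (mul_ne_zero (Nat.cast_add_one_ne_zero k) (pow_ne_zero k ha) : ((k : ℂ) + 1) * a ^ k ≠ 0) h1
    rw [hφg, Ad_eq_iff hg, hgn, add_mul, mul_add, h2, Matrix.smul_mul, one_mul]
    rw [autSL2_one_apply, Matrix.mul_smul, mul_one]

/-! ### Functions and matrices that are regular away from a lattice -/

/-- The function `U` is meromorphic on `ℂ` and holomorphic away from the lattice of `Λ`. -/
def Reg (Λ : PeriodPair) (U : ℂ → ℂ) : Prop :=
  (∀ z, MeromorphicAt U z) ∧ ∀ z ∉ Λ.lattice, AnalyticAt ℂ U z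

/-- All entries of a matrix of functions are regular. -/
def RegMat (Λ : PeriodPair) (A : ℂ → Matrix (Fin 2) (Fin 2) ℂ) : Prop :=
  ∀ i k, Reg Λ fun z => A z i k

section Reg

variable {Λ : PeriodPair} {U V : ℂ → ℂ} {A C : ℂ → Matrix (Fin 2) (Fin 2) ℂ}

theorem Reg.congr (hU : Reg Λ U) (h : ∀ z ∉ Λ.lattice, V z = U z) : Reg Λ V := by
  refine ⟨fun z => (hU.1 z).congr ?_, fun z hz => (hU.2 z hz).congr ?_⟩
  · filter_upwards [eventually_notMem_lattice Λ z] with w hw using (h w hw).symm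
  · filter_upwards [Λ.isClosed_lattice.isOpen_compl.mem_nhds hz] with w hw using (h w hw).symm

theorem Reg.const (Λ : PeriodPair) (c : ℂ) : Reg Λ fun _ => c :=
  ⟨fun z => MeromorphicAt.const c z, fun _ _ => analyticAt_const⟩

theorem Reg.add (hU : Reg Λ U) (hV : Reg Λ V) : Reg Λ fun z => U z + V z :=
  ⟨fun z => (hU.1 z).add (hV.1 z), fun z hz => (hU.2 z hz).add (hV.2 z hz)⟩

theorem Reg.mul (hU : Reg Λ U) (hV : Reg Λ V) : Reg Λ fun z => U z * V z :=
  ⟨fun z => (hU.1 z).mul (hV.1 z), fun z hz => (hU.2 z hz).mul (hV.2 z hz)⟩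

theorem Reg.neg (hU : Reg Λ U) : Reg Λ fun z => - U z :=
  ⟨fun z => (hU.1 z).neg, fun z hz => (hU.2 z hz).neg⟩

theorem Reg.sub (hU : Reg Λ U) (hV : Reg Λ V) : Reg Λ fun z => U z - V z :=
  ⟨fun z => (hU.1 z).sub (hV.1 z), fun z hz => (hU.2 z hz).sub (hV.2 z hz)⟩

theorem RegMat.mul (hA : RegMat Λ A) (hC : RegMat Λ C) : RegMat Λ fun z => A z * C z := by
  intro i k
  simp only [Matrix.mul_apply, Fin.sum_univ_two]
  exact ((hA i 0).mul (hC 0 k)).add ((hA i 1).mul (hC 1 k))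

/-- Determinant one makes the inverse the adjugate, so inversion creates no new poles. -/
theorem RegMat.inv (hA : RegMat Λ A) (hdet : ∀ z ∉ Λ.lattice, (A z).det = 1) :
    RegMat Λ fun z => (A z)⁻¹ := by
  have h1 : ∀ z ∉ Λ.lattice, (A z)⁻¹ = !![A z 1 1, - A z 0 1; - A z 1 0, A z 0 0] :=
    fun z hz => by rw [Matrix.inv_def, hdet z hz, Matrix.adjugate_fin_two]; simp
  have h2 : RegMat Λ fun z => !![A z 1 1, - A z 0 1; - A z 1 0, A z 0 0] := by
    intro i k
    fin_cases i <;> fin_cases k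
    · exact hA 1 1
    · exact (hA 0 1).neg
    · exact (hA 1 0).neg
    · exact hA 0 0
  exact fun i k => (h2 i k).congr fun z hz => congrFun (congrFun (h1 z hz) i) k

theorem RegMat.Ad (hA : RegMat Λ A) (hdet : ∀ z ∉ Λ.lattice, (A z).det = 1) {X : ℂ → SL2}
    (hX : RegMat Λ fun z => (X z).1) : RegMat Λ fun z => (Ad (A z) (X z)).1 :=
  (hA.mul hX).mul (hA.inv hdet)

theorem RegMat.aut {X : ℂ → SL2} (hX : RegMat Λ fun z => (X z).1) (B : AutSL2) :
    RegMat Λ fun z => (B (X z)).1 := by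
  intro i k
  have h1 : ∀ z, (B (X z)).1 i k = (X z).1 0 1 * (B stdE).1 i k + (X z).1 1 0 * (B stdF).1 i k +
      (X z).1 0 0 * (B stdH).1 i k := fun z => by
    conv_lhs => rw [(X z).eq_std]
    simp only [map_add, map_smul]
    rfl
  simp only [h1]
  exact (((hX 0 1).mul (Reg.const Λ _)).add ((hX 1 0).mul (Reg.const Λ _))).add
    ((hX 0 0).mul (Reg.const Λ _))

theorem RegMat.const (Λ : PeriodPair) (x : Matrix (Fin 2) (Fin 2) ℂ) : RegMat Λ fun _ => x :=
  fun _ _ => Reg.const Λ _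

end Reg

/-! ### Functions on the punctured torus and their lifts -/

/-- `Λ` is the preimage of the punctures. -/
def IsPreimage {L : PeriodPair} {Γ : Type*} [Group Γ] (σ : Γ →* translations L)
    (Λ : PeriodPair) : Prop := ∀ z, z ∈ Λ.lattice ↔ proj L z ∈ orbitZero σ

section Lift

variable {L Λ : PeriodPair} {Γ : Type*} [Group Γ] {σ : Γ →* translations L}

theorem IsPreimage.notMem (hΛ : IsPreimage σ Λ) {z : ℂ} (hz : proj L z ∉ orbitZero σ) :
    z ∉ Λ.lattice := fun h => hz ((hΛ z).1 h)

theorem IsPreimage.proj_notMem (hΛ : IsPreimage σ Λ) {z : ℂ} (hz : z ∉ Λ.lattice) :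
    proj L z ∉ orbitZero σ := fun h => hz ((hΛ z).2 h)

theorem IsPreimage.add_notMem (hΛ : IsPreimage σ Λ) {γ : Γ} {b : ℂ} (hb : (σ γ).1 0 = proj L b)
    {z : ℂ} (hz : z ∉ Λ.lattice) : z + b ∉ Λ.lattice := fun h => hz (by
  have hbΛ : b ∈ Λ.lattice := (hΛ b).2 ⟨γ, hb⟩
  simpa using sub_mem h hbΛ)

theorem Punctured.ind {p : Punctured σ → Prop}
    (h : ∀ z (hz : proj L z ∉ orbitZero σ), p ⟨proj L z, hz⟩) (q : Punctured σ) : p q := by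
  obtain ⟨q, hq⟩ := q
  obtain ⟨z, rfl⟩ := exists_proj_eq q
  exact h z hq

theorem move_proj {γ : Γ} {b : ℂ} (hb : (σ γ).1 0 = proj L b) {z : ℂ}
    (hz : proj L z ∉ orbitZero σ) (hzb : proj L (z + b) ∉ orbitZero σ) :
    move σ γ ⟨proj L z, hz⟩ = ⟨proj L (z + b), hzb⟩ :=
  Subtype.ext (by
    change (σ γ).1 (proj L z) = proj L (z + b)
    rw [proj_add, ← hb, translation_apply])

theorem move_inv_move (σ : Γ →* translations L) (γ : Γ) (p : Punctured σ) :
    move σ γ⁻¹ (move σ γ p) = p := Subtype.ext (by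
  change (σ γ⁻¹).1 ((σ γ).1 p.1) = p.1
  rw [map_inv]
  exact Equiv.symm_apply_apply _ _)

theorem move_move_inv (σ : Γ →* translations L) (γ : Γ) (p : Punctured σ) :
    move σ γ (move σ γ⁻¹ p) = p := by
  simpa using move_inv_move σ γ⁻¹ p

open Classical in
/-- The function on `ℂ` induced by a function on the punctured torus, set to `0` at punctures. -/
def liftFun (u : Fun σ) (z : ℂ) : ℂ :=
  if h : proj L z ∉ orbitZero σ then u.1 ⟨proj L z, h⟩ else 0

theorem liftFun_eq (u : Fun σ) {z : ℂ} (h : proj L z ∉ orbitZero σ) :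
    liftFun u z = u.1 ⟨proj L z, h⟩ := dif_pos h

theorem reg_liftFun (hΛ : IsPreimage σ Λ) (u : Fun σ) : Reg Λ (liftFun u) := by
  obtain ⟨U, hU, hU'⟩ := u.2
  refine Reg.congr (U := U) ⟨hU, fun z hz => (hU' z (hΛ.proj_notMem hz)).1⟩ fun z hz => ?_
  rw [liftFun_eq u (hΛ.proj_notMem hz), (hU' z (hΛ.proj_notMem hz)).2]

/-- A regular periodic function descends to the punctured torus. -/
theorem exists_isInduced (hΛ : IsPreimage σ Λ) {U : ℂ → ℂ} (hU : Reg Λ U)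
    (hper : ∀ l ∈ L.lattice, ∀ z ∉ Λ.lattice, U (z + l) = U z) : ∃ u : Fun σ, IsInduced u U := by
  choose s hs using exists_proj_eq (L := L)
  have key : ∀ z ∉ Λ.lattice, U (s (proj L z)) = U z := fun z hz => by
    have h1 := proj_eq_iff.1 (hs (proj L z))
    have h2 := hper _ h1 z hz
    rwa [add_sub_cancel] at h2
  exact ⟨⟨fun p => U (s p.1), U, hU.1, fun z hz => ⟨hU.2 z (hΛ.notMem hz),
    (key z (hΛ.notMem hz)).symm⟩⟩, fun z hz => key z (hΛ.notMem hz)⟩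

theorem mem_invFun_iff {u : Fun σ} : u ∈ invFun σ ↔ ∀ γ p, u.1 (move σ γ p) = u.1 p := by
  constructor
  · intro h γ p
    have h1 : u.1 (move σ γ⁻¹ (move σ γ p)) = u.1 (move σ γ p) :=
      congrFun (congrArg Subtype.val (h γ)) (move σ γ p)
    rw [← h1, move_inv_move]
  · intro h γ
    exact Subtype.ext (funext fun p => h γ⁻¹ p)

theorem mem_invFun_of_isInduced (hΛ : IsPreimage σ Λ) {u : Fun σ} {U : ℂ → ℂ}
    (hu : IsInduced u U) (hper : ∀ l ∈ Λ.lattice, ∀ z ∉ Λ.lattice, U (z + l) = U z) :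
    u ∈ invFun σ := by
  rw [mem_invFun_iff]
  refine fun γ => Punctured.ind fun z hz => ?_
  obtain ⟨b, hb⟩ := exists_proj_eq ((σ γ).1 0)
  have hz' := hΛ.add_notMem hb.symm (hΛ.notMem hz)
  rw [move_proj hb.symm hz (hΛ.proj_notMem hz'), hu, hu,
    hper b ((hΛ b).2 ⟨γ, hb.symm⟩) z (hΛ.notMem hz)]

theorem per_liftFun (hΛ : IsPreimage σ Λ) {u : Fun σ} (hu : u ∈ invFun σ) :
    Per Λ (liftFun u) := by
  intro l hl z
  obtain ⟨γ, hγ⟩ := (hΛ l).1 hl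
  by_cases hz : z ∈ Λ.lattice
  · have h1 : z + l ∈ Λ.lattice := add_mem hz hl
    rw [liftFun, liftFun, dif_neg (not_not.2 ((hΛ _).1 hz)), dif_neg (not_not.2 ((hΛ _).1 h1))]
  · have h1 := hΛ.add_notMem hγ hz
    rw [liftFun_eq u (hΛ.proj_notMem hz), liftFun_eq u (hΛ.proj_notMem h1),
      ← move_proj hγ (hΛ.proj_notMem hz), mem_invFun_iff.1 hu]

theorem PeriodPair.reg_weierstrassP (Λ : PeriodPair) : Reg Λ Λ.weierstrassP :=
  ⟨Λ.meromorphic_weierstrassP, fun z hz => Λ.analyticOnNhd_weierstrassP z hz⟩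

theorem PeriodPair.reg_derivWeierstrassP (Λ : PeriodPair) : Reg Λ Λ.derivWeierstrassP :=
  ⟨Λ.meromorphic_derivWeierstrassP, fun z hz => Λ.analyticOnNhd_derivWeierstrassP z hz⟩

/-- Induction on the pole order at `0`. Every order `n ≥ 2` is `2a + 3b`, so a multiple of `℘^a
℘'^b` removes the leading term; functions with at most a simple pole are constant. -/
theorem mem_adjoin_of_leadAt (hΛ : IsPreimage σ Λ) {p p' : Fun σ}
    (hp : IsInduced p Λ.weierstrassP) (hp' : IsInduced p' Λ.derivWeierstrassP)
    (hpi : p ∈ invFun σ) (hpi' : p' ∈ invFun σ) (n : ℕ) :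
    ∀ u ∈ invFun σ, ∀ c, LeadAt (liftFun u) 0 (-n) c → u ∈ Algebra.adjoin ℂ {p, p'} := by
  have hconst : ∀ u ∈ invFun σ, ∀ c, LeadAt (liftFun u) 0 (-1) c →
      u ∈ Algebra.adjoin ℂ {p, p'} := fun u hu c hc => by
    obtain ⟨k, hk⟩ := (per_liftFun hΛ hu).eq_const (reg_liftFun hΛ u).2 hc
    have : u = algebraMap ℂ (Fun σ) k := Subtype.ext (funext (Punctured.ind fun z hz => by
      rw [← liftFun_eq, hk z (hΛ.notMem hz)]
      rfl))
    rw [this]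
    exact Subalgebra.algebraMap_mem _ _
  induction n with
  | zero =>
    intro u hu c hc
    exact hconst u hu _ (hc.lower_le (by norm_num))
  | succ n ih =>
    intro u hu c hc
    by_cases hn : n = 0
    · subst hn
      exact hconst u hu c (by simpa using hc)
    obtain ⟨a, b, hab⟩ : ∃ a b : ℕ, 2 * a + 3 * b = n + 1 := by
      rcases Nat.even_or_odd' n with ⟨m, rfl | rfl⟩
      · exact ⟨m - 1, 1, by omega⟩
      · exact ⟨m + 1, 0, by omega⟩
    have hq : p ^ a * p' ^ b ∈ Algebra.adjoin ℂ {p, p'} :=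
      mul_mem (pow_mem (Algebra.subset_adjoin (by simp)) a)
        (pow_mem (Algebra.subset_adjoin (by simp)) b)
    have hqi : p ^ a * p' ^ b ∈ invFun σ := mul_mem (pow_mem hpi a) (pow_mem hpi' b)
    have hl := ((leadAt_weierstrassP Λ (zero_mem _)).pow a).mul
      ((leadAt_derivWeierstrassP Λ (zero_mem _)).pow b)
    have hexp : (a * -2 + b * -3 : ℤ) = -(n + 1 : ℕ) := by rw [← hab]; push_cast; ring
    rw [hexp, one_pow, one_mul] at hl
    have h2 : ((-2 : ℂ) ^ b) ≠ 0 := pow_ne_zero _ (by norm_num)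
    have hs := hc.sub (hl.const_mul (c / (-2) ^ b))
    rw [div_mul_cancel₀ _ h2, sub_self] at hs
    obtain ⟨d, hd⟩ := hs.succ
    have hsub := ih (u - (c / (-2) ^ b) • (p ^ a * p' ^ b))
      (sub_mem hu (Subalgebra.smul_mem _ hqi _)) d (by
        have e : (-(n + 1 : ℕ) + 1 : ℤ) = -n := by push_cast; ring
        rw [e] at hd
        refine hd.congr ?_
        filter_upwards [eventually_notMem_lattice Λ 0] with z hz
        have hz' := hΛ.proj_notMem hz
        rw [liftFun_eq _ hz', liftFun_eq _ hz', ← hp z hz', ← hp' z hz']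
        rfl)
    have := add_mem hsub (Subalgebra.smul_mem _ hq (c / (-2) ^ b))
    rwa [sub_add_cancel] at this

/-- The algebra of invariant functions is generated by `℘` and `℘'`. -/
theorem exists_invFun_eq_adjoin (hΛ : IsPreimage σ Λ) :
    ∃ p p' : Fun σ, IsInduced p Λ.weierstrassP ∧ IsInduced p' Λ.derivWeierstrassP ∧
      invFun σ = Algebra.adjoin ℂ {p, p'} := by
  have hle : ∀ l ∈ L.lattice, l ∈ Λ.lattice := fun l hl => (hΛ l).2 ⟨1, by
    rw [translation_one]
    exact ((Submodule.Quotient.mk_eq_zero _).2 hl).symm⟩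
  obtain ⟨p, hp⟩ := exists_isInduced hΛ (PeriodPair.reg_weierstrassP Λ)
    fun l hl z _ => per_weierstrassP Λ l (hle l hl) z
  obtain ⟨p', hp'⟩ := exists_isInduced hΛ (PeriodPair.reg_derivWeierstrassP Λ)
    fun l hl z _ => per_derivWeierstrassP Λ l (hle l hl) z
  have hpi := mem_invFun_of_isInduced hΛ hp fun l hl z _ => per_weierstrassP Λ l hl z
  have hpi' := mem_invFun_of_isInduced hΛ hp' fun l hl z _ => per_derivWeierstrassP Λ l hl z
  refine ⟨p, p', hp, hp', le_antisymm (fun u hu => ?_) ?_⟩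
  · obtain ⟨n, c, hc⟩ := exists_leadAt ((reg_liftFun hΛ u).1 0)
    obtain ⟨d, hd⟩ := hc.mono (m := -(n.natAbs : ℕ)) (by omega)
    exact mem_adjoin_of_leadAt hΛ hp hp' hpi hpi' _ u hu d hd
  · exact Algebra.adjoin_le (by rintro x (rfl | rfl) <;> assumption)

end Lift

/-! ### Evaluation of current algebra elements -/

section Current

variable {L Λ : PeriodPair} {Γ : Type*} [Group Γ] {σ : Γ →* translations L} {ρ : Γ →* AutSL2}

theorem exists_eq_tmul_std {R : Type*} [CommRing R] [Algebra ℂ R] (a : CurrentAlg R SL2) :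
    ∃ u v w : R, a = u ⊗ₜ stdE + v ⊗ₜ stdF + w ⊗ₜ stdH := by
  induction a using TensorProduct.induction_on with
  | zero => exact ⟨0, 0, 0, by simp⟩
  | tmul u x =>
    refine ⟨x.1 0 1 • u, x.1 1 0 • u, x.1 0 0 • u, ?_⟩
    conv_lhs => rw [x.eq_std]
    simp only [TensorProduct.tmul_add, TensorProduct.tmul_smul, TensorProduct.smul_tmul']
  | add a b ha hb =>
    obtain ⟨u, v, w, rfl⟩ := ha
    obtain ⟨u', v', w', rfl⟩ := hb
    refine ⟨u + u', v + v', w + w', ?_⟩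
    simp only [TensorProduct.add_tmul]
    abel

theorem eval_tmul (p : Punctured σ) (u : Fun σ) (x : SL2) :
    eval p (u ⊗ₜ[ℂ] x) = u.1 p • x := rfl

theorem eval_std (p : Punctured σ) (u v w : Fun σ) :
    (eval p (u ⊗ₜ[ℂ] stdE + v ⊗ₜ[ℂ] stdF + w ⊗ₜ[ℂ] stdH)).1 =
      !![w.1 p, u.1 p; v.1 p, - w.1 p] := by
  rw [map_add, map_add, eval_tmul, eval_tmul, eval_tmul]
  ext i k
  fin_cases i <;> fin_cases k <;> simp [stdE, stdF, stdH]

/-- Elements of the current algebra are determined by their values, so brackets, invariance and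
spanning can be checked pointwise. -/
theorem Current.ext_eval {a b : Current σ} (h : ∀ p, eval p a = eval p b) : a = b := by
  obtain ⟨u, v, w, rfl⟩ := exists_eq_tmul_std a
  obtain ⟨u', v', w', rfl⟩ := exists_eq_tmul_std b
  have h1 := fun p => congrArg Subtype.val (h p)
  simp only [eval_std] at h1
  have hu : u = u' := Subtype.ext (funext fun p => by
    simpa using congrFun (congrFun (h1 p) 0) 1)
  have hv : v = v' := Subtype.ext (funext fun p => by
    simpa using congrFun (congrFun (h1 p) 1) 0)
  have hw : w = w' := Subtype.ext (funext fun p => by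
    simpa using congrFun (congrFun (h1 p) 0) 0)
  rw [hu, hv, hw]

theorem eval_lie (p : Punctured σ) (a b : Current σ) :
    eval p ⁅a, b⁆ = ⁅eval p a, eval p b⁆ := by
  induction a using TensorProduct.induction_on with
  | zero => simp
  | add a a' ha ha' => rw [add_lie, map_add, map_add, add_lie, ha, ha']
  | tmul u x =>
    induction b using TensorProduct.induction_on with
    | zero => simp
    | add b b' hb hb' => rw [lie_add, map_add, map_add, lie_add, hb, hb']
    | tmul v y =>
      rw [LieAlgebra.ExtendScalars.bracket_tmul, eval_tmul, eval_tmul, eval_tmul, smul_lie,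
        lie_smul, smul_smul]
      rfl

theorem eval_smul (p : Punctured σ) (u : Fun σ) (a : Current σ) :
    eval p (u • a) = u.1 p • eval p a := by
  induction a using TensorProduct.induction_on with
  | zero => simp
  | add a b ha hb => rw [smul_add, map_add, map_add, smul_add, ha, hb]
  | tmul v x =>
    rw [TensorProduct.smul_tmul', eval_tmul, eval_tmul, smul_smul]
    rfl

theorem eval_inv_smul (p : Punctured σ) (u : invFun σ) (a : Current σ) :
    eval p (u • a) = u.1.1 p • eval p a := eval_smul p u.1 a

theorem eval_act (p : Punctured σ) (γ : Γ) (a : Current σ) :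
    eval p (act ρ σ γ a) = ρ γ (eval (move σ γ⁻¹ p) a) := by
  induction a using TensorProduct.induction_on with
  | zero => simp
  | add a b ha hb => rw [map_add, map_add, map_add, map_add, ha, hb]
  | tmul v x =>
    rw [eval_tmul, map_smul, act, LieAlgebra.ExtendScalars.map_apply_tmul, eval_tmul]
    rfl

theorem mem_aLia_iff {a : Current σ} :
    a ∈ aLia ρ σ ↔ ∀ γ p, eval (move σ γ p) a = ρ γ (eval p a) := by
  constructor
  · intro h γ p
    have h1 := eval_act (ρ := ρ) (move σ γ p) γ a
    rwa [move_inv_move, h γ] at h1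
  · intro h γ
    refine Current.ext_eval fun p => ?_
    rw [eval_act, ← h, move_move_inv]

theorem exists_current (hΛ : IsPreimage σ Λ) {X : ℂ → SL2} (hX : RegMat Λ fun z => (X z).1)
    (hper : ∀ l ∈ L.lattice, ∀ z ∉ Λ.lattice, X (z + l) = X z) :
    ∃ a : Current σ, ∀ z (hz : proj L z ∉ orbitZero σ), eval ⟨proj L z, hz⟩ a = X z := by
  have h := fun i k => exists_isInduced hΛ (hX i k) fun l hl z hz => by
    simp only [hper l hl z hz]
  obtain ⟨u, hu⟩ := h 0 1
  obtain ⟨v, hv⟩ := h 1 0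
  obtain ⟨w, hw⟩ := h 0 0
  refine ⟨u ⊗ₜ stdE + v ⊗ₜ stdF + w ⊗ₜ stdH, fun z hz => ?_⟩
  rw [map_add, map_add, eval_tmul, eval_tmul, eval_tmul, hu, hv, hw]
  exact (X z).eq_std.symm

open Classical in
/-- The function on `ℂ` induced by an element of the current algebra. -/
def liftCurrent (a : Current σ) (z : ℂ) : SL2 :=
  if h : proj L z ∉ orbitZero σ then eval ⟨proj L z, h⟩ a else 0

theorem liftCurrent_eq (a : Current σ) {z : ℂ} (h : proj L z ∉ orbitZero σ) :
    liftCurrent a z = eval ⟨proj L z, h⟩ a := dif_pos h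

theorem regMat_liftCurrent (hΛ : IsPreimage σ Λ) (a : Current σ) :
    RegMat Λ fun z => (liftCurrent a z).1 := by
  obtain ⟨u, v, w, rfl⟩ := exists_eq_tmul_std a
  have key : RegMat Λ fun z => !![liftFun w z, liftFun u z; liftFun v z, - liftFun w z] := by
    intro i k
    fin_cases i <;> fin_cases k
    · exact reg_liftFun hΛ w
    · exact reg_liftFun hΛ u
    · exact reg_liftFun hΛ v
    · exact (reg_liftFun hΛ w).neg
  refine fun i k => (key i k).congr fun z hz => ?_
  have hz' := hΛ.proj_notMem hz
  simp only [liftCurrent_eq _ hz', eval_std, liftFun_eq _ hz']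

/-! ### Normal forms from intertwiners -/

/-- An intertwiner of determinant one between the given and the trivial action yields a normal
form of the automorphic Lie algebra. -/
theorem exists_isNormalForm (hΛ : IsPreimage σ Λ) {Ψ : ℂ → Matrix (Fin 2) (Fin 2) ℂ}
    (B : AutSL2) (hΨ : RegMat Λ Ψ) (hdet : ∀ z ∉ Λ.lattice, (Ψ z).det = 1)
    (hequiv : ∀ (γ : Γ) (b : ℂ), (σ γ).1 0 = proj L b → ∀ z ∉ Λ.lattice, ∀ x,
      B (Ad (Ψ (z + b)) x) = ρ γ (B (Ad (Ψ z) x))) :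
    ∃ E F H : Current σ, IsNormalForm ρ σ E F H ∧ ∀ z (hz : proj L z ∉ orbitZero σ),
      eval ⟨proj L z, hz⟩ E = B (Ad (Ψ z) stdE) ∧ eval ⟨proj L z, hz⟩ F = B (Ad (Ψ z) stdF) ∧
      eval ⟨proj L z, hz⟩ H = B (Ad (Ψ z) stdH) := by
  have hunit : ∀ z ∉ Λ.lattice, IsUnit (Ψ z).det := fun z hz => by rw [hdet z hz]; exact isUnit_one
  -- Periods of `L` lift the trivial translation, so `hequiv` for `γ = 1` contains the
  -- `L`-periodicity needed to descend to the torus.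
  have hlat : ∀ l ∈ L.lattice, (σ 1).1 0 = proj L l := fun l hl => by
    rw [translation_one]
    exact ((Submodule.Quotient.mk_eq_zero _).2 hl).symm
  have hex : ∀ x : SL2, ∃ a : Current σ, ∀ z (hz : proj L z ∉ orbitZero σ),
      eval ⟨proj L z, hz⟩ a = B (Ad (Ψ z) x) := fun x =>
    exists_current hΛ ((hΨ.Ad hdet (RegMat.const Λ x.1)).aut B) fun l hl z hz => by
      rw [hequiv 1 l (hlat l hl) z hz, map_one, autSL2_one_apply]
  obtain ⟨E, hE⟩ := hex stdE
  obtain ⟨F, hF⟩ := hex stdF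
  obtain ⟨H, hH⟩ := hex stdH
  have hmem : ∀ (x : SL2) (a : Current σ), (∀ z (hz : proj L z ∉ orbitZero σ),
      eval ⟨proj L z, hz⟩ a = B (Ad (Ψ z) x)) → a ∈ aLia ρ σ := fun x a ha => by
    rw [mem_aLia_iff]
    refine fun γ => Punctured.ind fun z hz => ?_
    obtain ⟨b, hb⟩ := exists_proj_eq ((σ γ).1 0)
    rw [move_proj hb.symm hz (hΛ.proj_notMem (hΛ.add_notMem hb.symm (hΛ.notMem hz))), ha, ha,
      hequiv γ b hb.symm z (hΛ.notMem hz)]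
  have hcomb : ∀ (u v w : invFun σ) z (hz : proj L z ∉ orbitZero σ),
      eval ⟨proj L z, hz⟩ (u • E + v • F + w • H) = B (Ad (Ψ z) (u.1.1 ⟨proj L z, hz⟩ • stdE +
        v.1.1 ⟨proj L z, hz⟩ • stdF + w.1.1 ⟨proj L z, hz⟩ • stdH)) := fun u v w z hz => by
    rw [map_add, map_add, eval_inv_smul, eval_inv_smul, eval_inv_smul, hE z hz, hF z hz, hH z hz,
      Ad_add, Ad_add, Ad_smul_right, Ad_smul_right, Ad_smul_right, map_add, map_add,
      map_smul B, map_smul B, map_smul B]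
  have hstd : ∀ (x y t : ℂ), (x • stdE + y • stdF + t • stdH).1 = !![t, x; y, -t] := fun x y t => by
    ext i k
    fin_cases i <;> fin_cases k <;> simp [stdE, stdF, stdH]
  refine ⟨E, F, H, ⟨?_, ?_, ?_, ?_, ?_⟩, fun z hz => ⟨hE z hz, hF z hz, hH z hz⟩⟩
  · rw [Fintype.linearIndependent_iffₛ]
    intro c d hcd
    rw [Fin.sum_univ_three, Fin.sum_univ_three] at hcd
    change c 0 • E + c 1 • F + c 2 • H = d 0 • E + d 1 • F + d 2 • H at hcd
    have h0 : ∀ i z (hz : proj L z ∉ orbitZero σ),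
        (c i).1.1 ⟨proj L z, hz⟩ = (d i).1.1 ⟨proj L z, hz⟩ := fun i z hz => by
      have h1 := hcomb (c 0) (c 1) (c 2) z hz
      rw [hcd, hcomb] at h1
      have h2 := (Ad_eq_iff (hunit z (hΛ.notMem hz))).1 (B.injective h1)
      rw [Ad_val, Matrix.nonsing_inv_mul_cancel_right _ _ (hunit z (hΛ.notMem hz)), hstd,
        hstd] at h2
      have h4 := congrArg (fun X => (Ψ z)⁻¹ * X) h2
      simp only [Matrix.nonsing_inv_mul_cancel_left _ _ (hunit z (hΛ.notMem hz))] at h4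
      fin_cases i
      · simpa using (congrFun (congrFun h4 0) 1).symm
      · simpa using (congrFun (congrFun h4 1) 0).symm
      · simpa using (congrFun (congrFun h4 0) 0).symm
    exact fun i => Subtype.ext (Subtype.ext (funext (Punctured.ind (h0 i))))
  · ext a
    rw [SetLike.mem_coe, SetLike.mem_coe, Submodule.mem_span_triple]
    constructor
    · rintro ⟨u, v, w, rfl⟩
      have hinv : ∀ (u : invFun σ) (a : Current σ), a ∈ aLia ρ σ → u • a ∈ aLia ρ σ :=
        fun u a ha => by
        rw [mem_aLia_iff] at ha ⊢
        intro γ p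
        rw [eval_inv_smul, eval_inv_smul, mem_invFun_iff.1 u.2, ha, map_smul]
      exact add_mem (add_mem (hinv u E (hmem _ E hE)) (hinv v F (hmem _ F hF)))
        (hinv w H (hmem _ H hH))
    · intro ha
      set X := liftCurrent a with hX
      -- Undoing the intertwiner cancels the equivariance of `a`: `Y` is `Λ`-periodic, and its
      -- matrix entries are the invariant coefficients of `a` with respect to `E, F, H`.
      set Y : ℂ → SL2 := fun z => Ad (Ψ z)⁻¹ (B.symm (X z)) with hY
      have hXY : ∀ z ∉ Λ.lattice, B (Ad (Ψ z) (Y z)) = X z := fun z hz => by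
        rw [hY]
        simp only
        rw [← Ad_mul, Matrix.mul_nonsing_inv _ (hunit z hz), Ad_one, LieEquiv.apply_symm_apply]
      have hYX : ∀ z ∉ Λ.lattice, ∀ y, B (Ad (Ψ z) y) = X z → y = Y z := fun z hz y hy => by
        rw [hY]
        simp only
        rw [← hy, LieEquiv.symm_apply_apply, ← Ad_mul, Matrix.nonsing_inv_mul _ (hunit z hz),
          Ad_one]
      have hYreg : RegMat Λ fun z => (Y z).1 := by
        have h1 := hΨ.inv hdet
        exact h1.Ad (fun z hz => by rw [Matrix.det_nonsing_inv, hdet z hz, Ring.inverse_one])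
          ((regMat_liftCurrent hΛ a).aut B.symm)
      have hYper : ∀ l ∈ Λ.lattice, ∀ z ∉ Λ.lattice, Y (z + l) = Y z := fun l hl z hz => by
        obtain ⟨γ, hγ⟩ := (hΛ l).1 hl
        have hzl := hΛ.add_notMem hγ hz
        refine (hYX _ hzl _ ?_).symm
        rw [hequiv γ l hγ z hz, hXY z hz, hX, liftCurrent_eq a (hΛ.proj_notMem hz),
          liftCurrent_eq a (hΛ.proj_notMem hzl), ← move_proj hγ (hΛ.proj_notMem hz),
          mem_aLia_iff.1 ha]
      have hle : ∀ l ∈ L.lattice, l ∈ Λ.lattice := fun l hl => (hΛ l).2 ⟨1, hlat l hl⟩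
      have hcoef : ∀ i k, ∃ u : invFun σ, ∀ z (hz : proj L z ∉ orbitZero σ),
          u.1.1 ⟨proj L z, hz⟩ = (Y z).1 i k := fun i k => by
        obtain ⟨u, hu⟩ := exists_isInduced hΛ (hYreg i k) fun l hl z hz => by
          simp only [hYper l (hle l hl) z hz]
        exact ⟨⟨u, mem_invFun_of_isInduced hΛ hu fun l hl z hz => by
          simp only [hYper l hl z hz]⟩, hu⟩
      obtain ⟨u, hu⟩ := hcoef 0 1
      obtain ⟨v, hv⟩ := hcoef 1 0
      obtain ⟨w, hw⟩ := hcoef 0 0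
      refine ⟨u, v, w, Current.ext_eval (Punctured.ind fun z hz => ?_)⟩
      rw [hcomb, hu, hv, hw, ← (Y z).eq_std, hXY z (hΛ.notMem hz), hX, liftCurrent_eq a hz]
  · refine Current.ext_eval (Punctured.ind fun z hz => ?_)
    rw [eval_lie, map_smul, hE z hz, hH z hz, ← LieEquiv.map_lie,
      ← Ad_lie (hunit z (hΛ.notMem hz)), lie_stdH_stdE, Ad_smul_right, map_smul B]
  · refine Current.ext_eval (Punctured.ind fun z hz => ?_)
    rw [eval_lie, map_smul, hF z hz, hH z hz, ← LieEquiv.map_lie,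
      ← Ad_lie (hunit z (hΛ.notMem hz)), lie_stdH_stdF, Ad_smul_right, map_smul B]
  · refine Current.ext_eval (Punctured.ind fun z hz => ?_)
    rw [eval_lie, hE z hz, hF z hz, hH z hz, ← LieEquiv.map_lie,
      ← Ad_lie (hunit z (hΛ.notMem hz)), lie_stdE_stdF]

/-! ### Normal forms and current algebras -/

section NormalForm

variable {E F H : Current σ}

/-- The linear map from `sl₂` to the current algebra with values `E, F, H` on the standard basis. -/
def stdMap (E F H : Current σ) : SL2 →ₗ[ℂ] Current σ where
  toFun x := x.1 0 1 • E + x.1 1 0 • F + x.1 0 0 • H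
  map_add' x y := by
    have h : ∀ i k, (x + y).1 i k = x.1 i k + y.1 i k := fun _ _ => rfl
    simp only [h, add_smul]
    abel
  map_smul' c x := by
    have h : ∀ i k, (c • x).1 i k = c * x.1 i k := fun _ _ => rfl
    simp only [h, mul_smul, smul_add, RingHom.id_apply]

theorem stdMap_apply (E F H : Current σ) (x : SL2) :
    stdMap E F H x = x.1 0 1 • E + x.1 1 0 • F + x.1 0 0 • H := rfl

theorem stdMap_lie (h : IsNormalForm ρ σ E F H) (x y : SL2) :
    stdMap E F H ⁅x, y⁆ = ⁅stdMap E F H x, stdMap E F H y⁆ := by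
  have h1 : ⁅E, H⁆ = -((2 : ℂ) • E) := by rw [← lie_skew, h.lie_H_E]
  have h2 : ⁅F, H⁆ = -((-2 : ℂ) • F) := by rw [← lie_skew, h.lie_H_F]
  have h3 : ⁅F, E⁆ = -H := by rw [← lie_skew, h.lie_E_F]
  have hx := x.trace_eq_zero
  have hy := y.trace_eq_zero
  have hx' : x.1 1 1 = - x.1 0 0 := by linear_combination hx
  have hy' : y.1 1 1 = - y.1 0 0 := by linear_combination hy
  simp only [stdMap_apply, SL2.lie_val, Matrix.sub_apply, Matrix.mul_apply, Fin.sum_univ_two,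
    add_lie, lie_add, smul_lie, lie_smul, lie_self, h1, h2, h3, h.lie_H_E, h.lie_H_F, h.lie_E_F,
    hx', hy']
  module

/-- The endomorphism of the current algebra that is linear over the functions and sends the
standard basis to `E, F, H`. -/
def currentMap (E F H : Current σ) : Current σ →ₗ[Fun σ] Current σ :=
  (stdMap E F H).liftBaseChange (Fun σ)

theorem currentMap_tmul (E F H : Current σ) (u : Fun σ) (x : SL2) :
    currentMap E F H (u ⊗ₜ x) = u • stdMap E F H x := by
  rw [currentMap, LinearMap.liftBaseChange_tmul]

theorem currentMap_lie (h : IsNormalForm ρ σ E F H) (a b : Current σ) :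
    currentMap E F H ⁅a, b⁆ = ⁅currentMap E F H a, currentMap E F H b⁆ := by
  induction a using TensorProduct.induction_on with
  | zero => rw [zero_lie, map_zero, zero_lie]
  | add a a' ha ha' => rw [add_lie, map_add, map_add, add_lie, ha, ha']
  | tmul u x =>
    induction b using TensorProduct.induction_on with
    | zero => rw [lie_zero, map_zero, lie_zero]
    | add b b' hb hb' => rw [lie_add, map_add, map_add, lie_add, hb, hb']
    | tmul v y =>
      rw [LieAlgebra.ExtendScalars.bracket_tmul, currentMap_tmul, currentMap_tmul,
        currentMap_tmul, stdMap_lie h]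
      refine Current.ext_eval fun p => ?_
      rw [eval_smul, eval_lie, eval_lie, eval_smul, eval_smul, smul_lie, lie_smul, smul_smul]
      rfl

/-- The map from the current algebra over the invariant functions given by `E, F, H`. -/
def baseMap (E F H : Current σ) : CurrentAlg (invFun σ) SL2 →ₗ[ℂ] Current σ :=
  (currentMap E F H).restrictScalars ℂ ∘ₗ
    (LieAlgebra.ExtendScalars.map (invFun σ).val (1 : SL2 →ₗ⁅ℂ⁆ SL2)).toLinearMap

theorem baseMap_tmul (E F H : Current σ) (u : invFun σ) (x : SL2) :
    baseMap E F H (u ⊗ₜ x) = u • stdMap E F H x := currentMap_tmul E F H u.1 x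

theorem baseMap_lie (h : IsNormalForm ρ σ E F H) (a b : CurrentAlg (invFun σ) SL2) :
    baseMap E F H ⁅a, b⁆ = ⁅baseMap E F H a, baseMap E F H b⁆ := by
  have h1 := (LieAlgebra.ExtendScalars.map (invFun σ).val (1 : SL2 →ₗ⁅ℂ⁆ SL2)).map_lie a b
  change currentMap E F H _ = _
  exact (congrArg (currentMap E F H) h1).trans (currentMap_lie h _ _)

theorem baseMap_std (E F H : Current σ) (u v w : invFun σ) :
    baseMap E F H (u ⊗ₜ stdE + v ⊗ₜ stdF + w ⊗ₜ stdH) = u • E + v • F + w • H := by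
  have h1 : stdMap E F H stdE = E := by simp [stdMap_apply, stdE]
  have h2 : stdMap E F H stdF = F := by simp [stdMap_apply, stdF]
  have h3 : stdMap E F H stdH = H := by simp [stdMap_apply, stdH]
  rw [map_add, map_add, baseMap_tmul, baseMap_tmul, baseMap_tmul, h1, h2, h3]

/-- `baseMap` respects brackets; freeness makes it injective, and the span condition identifies its
image. -/
theorem IsNormalForm.nonempty_equiv (h : IsNormalForm ρ σ E F H) :
    Nonempty (aLia ρ σ ≃ₗ⁅ℂ⁆ CurrentAlg (invFun σ) SL2) := by
  have hmem : ∀ a, baseMap E F H a ∈ aLia ρ σ := fun a => by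
    obtain ⟨u, v, w, rfl⟩ := exists_eq_tmul_std a
    rw [baseMap_std, ← SetLike.mem_coe, ← h.span_eq, SetLike.mem_coe, Submodule.mem_span_triple]
    exact ⟨u, v, w, rfl⟩
  let f : CurrentAlg (invFun σ) SL2 →ₗ⁅ℂ⁆ aLia ρ σ :=
    { toFun := fun a => ⟨baseMap E F H a, hmem a⟩
      map_add' := fun a b => Subtype.ext (map_add _ a b)
      map_smul' := fun c a => Subtype.ext ((baseMap E F H).map_smul c a)
      map_lie' := fun {a b} => Subtype.ext (baseMap_lie h a b) }
  refine ⟨(LieEquiv.ofBijective f ⟨?_, ?_⟩).symm⟩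
  · intro a b hab
    obtain ⟨u, v, w, rfl⟩ := exists_eq_tmul_std a
    obtain ⟨u', v', w', rfl⟩ := exists_eq_tmul_std b
    have h1 : baseMap E F H (u ⊗ₜ stdE + v ⊗ₜ stdF + w ⊗ₜ stdH) =
      baseMap E F H (u' ⊗ₜ stdE + v' ⊗ₜ stdF + w' ⊗ₜ stdH) := congrArg Subtype.val hab
    rw [baseMap_std, baseMap_std] at h1
    have h2 := Fintype.linearIndependent_iffₛ.1 h.linearIndependent ![u, v, w] ![u', v', w']
      (by rw [Fin.sum_univ_three, Fin.sum_univ_three]; exact h1)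
    have hu : u = u' := h2 0
    have hv : v = v' := h2 1
    have hw : w = w' := h2 2
    rw [hu, hv, hw]
  · rintro ⟨a, ha⟩
    rw [← SetLike.mem_coe, ← h.span_eq, SetLike.mem_coe, Submodule.mem_span_triple] at ha
    obtain ⟨u, v, w, rfl⟩ := ha
    exact ⟨_, Subtype.ext (baseMap_std E F H u v w)⟩

end NormalForm

end Current

/-! ### The intertwiner `Φ_j` -/

section Phi

variable {L L' Λ : PeriodPair} {M : ℕ} {α : ℂ} {j : ℤ} {lam mu : ℂ}

theorem delta_add (M : ℕ) (j k : ℤ) : delta M (j + k) = delta M j * delta M k := by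
  have h : -(j + k) = -j + -k := by ring
  simp [delta, h, omega_add]

/-- All terms of the first row have character `ω^{kj}`, and all terms of the second row `ω^{-kj}`.
-/
theorem Phi_add_int (h : HasTorsion L M α) (j : ℤ) (lam mu : ℂ) (k : ℤ) (z : ℂ) :
    Phi L M α j lam mu (z + k * α) = delta M (k * j) * Phi L M α j lam mu z := by
  have h1 : omega M (-(k * j)) * omega M (-(k * (-2 * j))) = omega M (k * j) := by
    rw [← omega_add]
    congr 1
    ring
  have h2 : omega M (k * j) * omega M (-(k * (2 * j))) = omega M (-(k * j)) := by
    rw [← omega_add]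
    congr 1
    ring
  have h3 : -(k * -j) = k * j := by ring
  rw [Phi, Phi, delta]
  simp only [P_add_int h, h3]
  ext a b
  fin_cases a <;> fin_cases b <;> simp only [Fin.zero_eta, Fin.mk_one, Fin.isValue, of_apply,
    cons_val', cons_val_zero, cons_val_one, cons_val_fin_one, Matrix.mul_apply, Fin.sum_univ_two,
    zero_mul, add_zero, zero_add]
  · linear_combination (1 / mu * P L M α j z * P L M α (-2 * j) z) * h1
  · linear_combination (1 / mu * P L M α (-j) z * P L M α (2 * j) z) * h2

theorem Phi_add_lattice (L : PeriodPair) (M : ℕ) (α : ℂ) (j : ℤ) (lam mu : ℂ) {l : ℂ}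
    (hl : l ∈ L.lattice) (z : ℂ) : Phi L M α j lam mu (z + l) = Phi L M α j lam mu z := by
  simp only [Phi, per_P L M α _ l hl]

theorem regMat_Phi (h : HasTorsion L M α) (hΛ : IsExtension L α Λ) (j : ℤ) (lam mu : ℂ) :
    RegMat Λ (Phi L M α j lam mu) := by
  have hP : ∀ i, Reg Λ (P L M α i) := fun i =>
    ⟨meromorphicAt_P h hΛ i, fun z hz => analyticAt_P h hΛ i hz⟩
  intro a b
  fin_cases a <;> fin_cases b
  · exact hP (-j)
  · exact (((Reg.const Λ (1 / mu)).mul (hP j)).mul (hP (-2 * j))).add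
      ((Reg.const Λ (lam / (2 * mu))).mul (hP (-j)))
  · exact hP j
  · exact (((Reg.const Λ (1 / mu)).mul (hP (-j))).mul (hP (2 * j))).sub
      ((Reg.const Λ (lam / (2 * mu))).mul (hP j))

/-- The products without `λ` contribute `G / μ`, and those with `λ` contribute `-(λ / μ) P_{-j}
P_j`. -/
theorem det_Phi (hmu : mu ≠ 0) {z : ℂ}
    (h : P L M α (2 * j) z * P L M α (-j) z ^ 2 - P L M α (-2 * j) z * P L M α j z ^ 2 =
      lam * P L M α (-j) z * P L M α j z + mu) : (Phi L M α j lam mu z).det = 1 := by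
  rw [Phi, Matrix.det_fin_two_of]
  field_simp
  linear_combination 2 * h

/-- Here `L` plays the role of the cover. If `b - kα` is not one of its periods, the correction by
`Nα` multiplies `Φ` by `δ_{Nj}`, which is scalar as `M = 2N`, and `Ad` does not see it. -/
theorem Ad_Phi_add (h : HasTorsion L M α) {N : ℕ} {k : ℤ} {b : ℂ}
    (hb : b - k * α ∈ L.lattice ∨ Even N ∧ b - k * α - N * α ∈ L.lattice)
    (hM : Even N → (N : ℤ) * 2 = M) (z : ℂ) (x : SL2) :
    Ad (Phi L M α j lam mu (z + b)) x = Ad (delta M (k * j) * Phi L M α j lam mu z) x := by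
  rcases hb with h1 | ⟨heven, h1⟩
  · have e : z + b = z + k * α + (b - k * α) := by ring
    rw [e, Phi_add_lattice L M α j lam mu h1, Phi_add_int h]
  · have e : z + b = z + k * α + (N : ℤ) * α + (b - k * α - N * α) := by
      push_cast
      ring
    rw [e, Phi_add_lattice L M α j lam mu h1, Phi_add_int h, Ad_mul, Phi_add_int h,
      Ad_delta_of_dvd h.ne_zero ⟨j, by rw [← hM heven]; ring⟩]

end Phi

/-! ### The intertwiner for a cyclic group with given generator. -/

section Generator

variable {L Λ : PeriodPair} {Γ : Type*} [Group Γ] {σ : Γ →* translations L} {ρ : Γ →* AutSL2}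

theorem rho_zpow_apply {r : Γ} {M : ℕ} {j : ℤ} {B : AutSL2}
    (hB : ∀ x, ρ r x = B (Ad (delta M j) (B.symm x))) (k : ℤ) (x : SL2) :
    ρ (r ^ k) (B x) = B (Ad (delta M (k * j)) x) := by
  have hB' : ∀ x, ρ r (B x) = B (Ad (delta M j) x) := fun x => by
    rw [hB, LieEquiv.symm_apply_apply]
  induction k using Int.induction_on generalizing x with
  | zero =>
    have h : delta M (0 * j) = 1 := by simp [delta, omega_zero, Matrix.one_fin_two]
    rw [zpow_zero, map_one, autSL2_one_apply, h, Ad_one]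
  | succ k ih =>
    have h : ((k : ℤ) + 1) * j = k * j + j := by ring
    rw [_root_.zpow_add_one, map_mul, autSL2_mul_apply, hB', ih, ← Ad_mul, ← delta_add, h]
  | pred k ih =>
    have h1 : r ^ (-k : ℤ) = r ^ (-k - 1 : ℤ) * r := by rw [← _root_.zpow_add_one]; congr 1; ring
    have h2 : delta M ((-k - 1) * j) = delta M (-k * j) * delta M (-j) := by
      rw [← delta_add]
      congr 1
      ring
    have h3 : delta M j * delta M (-j) = 1 := by
      rw [← delta_add, add_neg_cancel]
      simp [delta, omega_zero, Matrix.one_fin_two]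
    have h4 := ih (Ad (delta M (-j)) x)
    rw [h1, map_mul, autSL2_mul_apply, hB', ← Ad_mul, h3, Ad_one] at h4
    rw [h4, h2, Ad_mul]

theorem explicit_normalForm [Finite Γ] (hρ : Function.Injective ρ) (hσ : Function.Injective σ)
    (hΛ : IsPreimage σ Λ) (hcard : 2 ≤ Nat.card Γ) {r : Γ}
    (hr : ∀ γ : Γ, γ ∈ Subgroup.zpowers r) {α : ℂ} (hα : (σ r).1 0 = proj L α) (M : ℕ)
    (L' : PeriodPair) (hM : M = coverOrder (Nat.card Γ)) (hL' : L' = cover L (Nat.card Γ) α) :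
    (∃ (j : ℤ) (B : AutSL2), ∀ x, ρ r x = B (Ad (delta M j) (B.symm x))) ∧
    ∀ (j : ℤ) (B : AutSL2), (∀ x, ρ r x = B (Ad (delta M j) (B.symm x))) →
      ¬ (M : ℤ) ∣ 2 * j ∧
      ∃ lam mu : ℂ, mu ≠ 0 ∧
        (∀ z ∉ Λ.lattice,
          P L' M α (2 * j) z * P L' M α (-j) z ^ 2 - P L' M α (-2 * j) z * P L' M α j z ^ 2 =
            lam * P L' M α (-j) z * P L' M α j z + mu) ∧
        (∀ z ∉ Λ.lattice, (Phi L' M α j lam mu z).det = 1 ∧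
          Phi L' M α j lam mu (z + α) = delta M j * Phi L' M α j lam mu z) ∧
        ∃ E F H : Current σ, IsNormalForm ρ σ E F H ∧
          ∀ (z : ℂ) (hz : proj L z ∉ orbitZero σ),
            eval ⟨proj L z, hz⟩ E = B (Ad (Phi L' M α j lam mu z) stdE) ∧
            eval ⟨proj L z, hz⟩ F = B (Ad (Phi L' M α j lam mu z) stdF) ∧
            eval ⟨proj L z, hz⟩ H = B (Ad (Phi L' M α j lam mu z) stdH) := by
  have hmul := mul_mem_lattice_iff hσ hr hα
  have hext : IsExtension L α Λ := fun z => (hΛ z).trans (mem_orbitZero_iff hr hα z)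
  obtain ⟨htor, hext', hcov⟩ := hasTorsion_cover hcard hmul hext
  rw [← hM, ← hL'] at htor
  rw [← hL'] at hext' hcov
  have hρr : ρ r ≠ 1 := fun h => by
    have hr1 : r = 1 := hρ (by rw [h, map_one])
    have h2 := orderOf_eq_card_of_forall_mem_zpowers hr
    rw [hr1, orderOf_one] at h2
    omega
  refine ⟨?_, fun j B hB => ?_⟩
  · rw [hM]
    refine exists_conj_delta (N := Nat.card Γ) (by omega) ?_ hρr
    rw [← map_pow, pow_card_eq_one', map_one]
  -- Otherwise `Ad(δ_j)` would be trivial, against the injectivity of `ρ`.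
  have hj : ¬ (M : ℤ) ∣ 2 * j := fun hdvd => hρr (LieEquiv.ext fun x => by
    rw [hB, Ad_delta_of_dvd htor.ne_zero hdvd, LieEquiv.apply_symm_apply, autSL2_one_apply])
  obtain ⟨lam, mu, hmu, hrel⟩ := exists_P_relation htor hext' hj
  have hdet : ∀ z ∉ Λ.lattice, (Phi L' M α j lam mu z).det = 1 := fun z hz =>
    det_Phi hmu (hrel z hz)
  refine ⟨hj, lam, mu, hmu, hrel, fun z hz => ⟨hdet z hz, ?_⟩, ?_⟩
  · simpa using Phi_add_int htor j lam mu 1 z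
  refine exists_isNormalForm hΛ B (regMat_Phi htor hext' j lam mu) hdet fun γ b hb z _ x => ?_
  obtain ⟨k, rfl⟩ := Subgroup.mem_zpowers_iff.1 (hr γ)
  rw [translation_zpow σ hα] at hb
  rw [rho_zpow_apply hB, ← Ad_mul]
  have h2j : (Nat.card Γ : ℤ) * 2 = M ∨ ¬ Even (Nat.card Γ) := by
    by_cases heven : Even (Nat.card Γ)
    · left
      rw [hM, coverOrder, if_neg (Nat.not_odd_iff_even.2 heven)]
      push_cast
      ring
    · exact Or.inr heven
  refine congrArg B (Ad_Phi_add htor (hcov _ (proj_eq_iff.1 hb.symm)) (fun heven => ?_) z x)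
  exact h2j.resolve_right (not_not_intro heven)

end Generator

end TorusALia

end

/-! ### The main theorem. -/

theorem mainTheorem2 (L : PeriodPair) {Γ : Type*} [Group Γ] [Finite Γ] [IsCyclic Γ]
    (ρ : Γ →* TorusALia.AutSL2) (σ : Γ →* TorusALia.translations L)
    (hρ : Function.Injective ρ) (hσ : Function.Injective σ) :
    -- the automorphic Lie algebra is isomorphic to a current algebra
    Nonempty (TorusALia.aLia ρ σ ≃ₗ⁅ℂ⁆ TorusALia.CurrentAlg (TorusALia.invFun σ) TorusALia.SL2) ∧
    -- the lattice `Λ` is the preimage of the orbit of `0`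
    ∃ Λ : PeriodPair,
      (∀ z : ℂ, z ∈ Λ.lattice ↔ TorusALia.proj L z ∈ TorusALia.orbitZero σ) ∧
      -- the algebra of invariant functions is `ℂ[℘_Λ, ℘'_Λ]`
      (∃ p p' : TorusALia.Fun σ, TorusALia.IsInduced p Λ.weierstrassP ∧
        TorusALia.IsInduced p' Λ.derivWeierstrassP ∧
        TorusALia.invFun σ = Algebra.adjoin ℂ {p, p'}) ∧
      -- there is a normal form
      (∃ E F H : TorusALia.Current σ, TorusALia.IsNormalForm ρ σ E F H) ∧
      -- the explicit normal form, for a generator `r` acting as translation by `α`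
      (2 ≤ Nat.card Γ → ∀ r : Γ, (∀ γ : Γ, γ ∈ Subgroup.zpowers r) →
        ∀ α : ℂ, (σ r).1 0 = TorusALia.proj L α →
        ∀ (M : ℕ) (L' : PeriodPair), M = TorusALia.coverOrder (Nat.card Γ) →
        L' = TorusALia.cover L (Nat.card Γ) α →
        -- `ρ` is conjugate to a diagonal action `Ad ∘ δ_{j,M}`
        (∃ (j : ℤ) (B : TorusALia.AutSL2),
          ∀ x, ρ r x = B (TorusALia.Ad (TorusALia.delta M j) (B.symm x))) ∧
        -- and for each such conjugation the intertwiner `Φ_j` yields a normal form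
        ∀ (j : ℤ) (B : TorusALia.AutSL2),
          (∀ x, ρ r x = B (TorusALia.Ad (TorusALia.delta M j) (B.symm x))) →
          ¬ (M : ℤ) ∣ 2 * j ∧
          ∃ lam mu : ℂ, mu ≠ 0 ∧
            (∀ z ∉ Λ.lattice,
              TorusALia.P L' M α (2 * j) z * TorusALia.P L' M α (-j) z ^ 2 -
                TorusALia.P L' M α (-2 * j) z * TorusALia.P L' M α j z ^ 2 =
              lam * TorusALia.P L' M α (-j) z * TorusALia.P L' M α j z + mu) ∧
            (∀ z ∉ Λ.lattice, (TorusALia.Phi L' M α j lam mu z).det = 1 ∧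
              TorusALia.Phi L' M α j lam mu (z + α) =
                TorusALia.delta M j * TorusALia.Phi L' M α j lam mu z) ∧
            ∃ E F H : TorusALia.Current σ, TorusALia.IsNormalForm ρ σ E F H ∧
              ∀ (z : ℂ) (hz : TorusALia.proj L z ∉ TorusALia.orbitZero σ),
                TorusALia.eval ⟨TorusALia.proj L z, hz⟩ E =
                  B (TorusALia.Ad (TorusALia.Phi L' M α j lam mu z) TorusALia.stdE) ∧
                TorusALia.eval ⟨TorusALia.proj L z, hz⟩ F =
                  B (TorusALia.Ad (TorusALia.Phi L' M α j lam mu z) TorusALia.stdF) ∧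
                TorusALia.eval ⟨TorusALia.proj L z, hz⟩ H =
                  B (TorusALia.Ad (TorusALia.Phi L' M α j lam mu z) TorusALia.stdH)) := by
  obtain ⟨r, hr⟩ := IsCyclic.exists_generator (α := Γ)
  obtain ⟨α, hα⟩ := TorusALia.exists_proj_eq ((σ r).1 0)
  have hmul := TorusALia.mul_mem_lattice_iff hσ hr hα.symm
  obtain ⟨Λ, hext⟩ := TorusALia.exists_isExtension L (α := α) (N := Nat.card Γ)
    Nat.card_pos.ne' (by
      have := (hmul (Nat.card Γ)).2 dvd_rfl
      exact_mod_cast this)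
  have hΛ : TorusALia.IsPreimage σ Λ := fun z =>
    (hext z).trans (TorusALia.mem_orbitZero_iff hr hα.symm z).symm
  have hnf : ∃ E F H : TorusALia.Current σ, TorusALia.IsNormalForm ρ σ E F H := by
    by_cases hcard : 2 ≤ Nat.card Γ
    · obtain ⟨⟨j, B, hB⟩, h⟩ := TorusALia.explicit_normalForm hρ hσ hΛ hcard hr hα.symm _ _ rfl rfl
      obtain ⟨-, lam, mu, -, -, -, E, F, H, hE, -⟩ := h j B hB
      exact ⟨E, F, H, hE⟩
    -- For the trivial group the constant intertwiner `1` suffices.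
    · have hsub : Subsingleton Γ := Finite.card_le_one_iff_subsingleton.1 (by omega)
      obtain ⟨E, F, H, hE, -⟩ := TorusALia.exists_isNormalForm (ρ := ρ) hΛ (Ψ := fun _ => 1) 1
        (TorusALia.RegMat.const Λ 1) (fun _ _ => Matrix.det_one) fun γ b _ z _ x => by
          rw [Subsingleton.elim γ 1, map_one]
          rfl
      exact ⟨E, F, H, hE⟩
  obtain ⟨E, F, H, hE⟩ := hnf
  exact ⟨hE.nonempty_equiv, Λ, hΛ, TorusALia.exists_invFun_eq_adjoin hΛ, ⟨E, F, H, hE⟩,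
    fun hcard r hr α hα M L' hM hL' =>
      TorusALia.explicit_normalForm hρ hσ hΛ hcard hr hα M L' hM hL'⟩
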